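/- **Setting.** $\mathcal D'$ is the space of complex Schwartz distributions on $\mathbb R$; derivatives are distributional, and locally integrable functions are identified with the corresponding regular distributions. The singular support of $F\in\mathcal D'$ is the complement of the largest open set on which $F$ is a smooth function. The order $\operatorname{ord}F$ is the least $n\ge 0$ such that $F$ is the $n$-th derivative of a regular distribution (so $\operatorname{ord}\delta^{(j)}=j+1$). Let $\mathcal C^\infty_p$ be the space of functions $\mathbb R\to\mathbb C$ that are smooth except on a finite set of points, at which they and all their derivatives have finite left and right limits, and let $\mathcal A\subset\mathcal D'$ be the space of all elements of $\mathcal C_p^\infty$ together with all their distributional derivatives of all orders. For $F,G\in\mathcal A$ put $$F*G=\lim_{\epsilon\downarrow0}F(x)\cdot G(x+\epsilon)$$ (limit in $\mathcal D'$), where $\cdot$ is the Hörmander product of distributions with disjoint singular supports, defined as follows: take a finite open cover of $\mathbb R$ such that on each of its members one of the two factors is a smooth function; the product is the unique distribution that on each member equals the usual product of the other factor by this smooth function. Let $n\ge0$, $a_i,b_i\in\mathcal A$ ($i=0,\dots,n$), $f\in\mathcal C^\infty(\mathbb R)$, and consider the equation $$\sum_{i=0}^n\bigl(a_i*\psi^{(i)}+\psi^{(i)}*b_i\bigr)=f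 .\qquad(1)$$ A solution of (1) is a $\psi\in\mathcal A$ satisfying (1) in $\mathcal D'$. Let $I=\{\xi_1<\dots<\xi_m\}$ be the singular set of (1), i.e. the (finite) union of the singular supports of all $a_i$ and $b_i$. An open interval is regular if it does not meet $I$. For a regular open interval $\Omega$ let $a_{i\overline\Omega},b_{i\overline\Omega}\in\mathcal C^\infty(\overline\Omega)$ be the smooth extensions of $a_i|_\Omega,b_i|_\Omega$ to $\overline\Omega$. **Theorem.** Assume that - (C1) $a_n(\xi^-)+b_n(\xi^+)\neq0$ for all $\xi\in I$, where $\xi^-$ and $\xi^+$ denote left and right limits at $\xi$ of the smooth functions that represent $a_n$ and $b_n$ to the left and to the right of $\xi$; - (C2) for every regular open interval $\Omega$, $a_{n\overline\Omega}(x)+b_{n\overline\Omega}(x)\neq0$ for all $x\in\overline\Omega$. Let $\Omega_k=(\xi_k,\xi_{k+1})$, $k=0,\dots,m$, with $\xi_0=-\infty$, $\xi_{m+1}=+\infty$, and let $M=\max\{\operatorname{ord}a_i,\operatorname{ord}b_i:\ 0\le i\le n\}$. Then every solution $\psi$ of (1) is of the form $$\psi=\sum_{k=0}^m\chi_{\Omega_k}\psi_k+\Delta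 ,$$ where $\psi_k\in\mathcal C^\infty(\overline{\Omega_k})$ satisfies $$\sum_{i=0}^n\bigl(a_{i\overline{\Omega_k}}+b_{i\overline{\Omega_k}}\bigr)\psi_k^{(i)}=f\quad\text{on }\overline{\Omega_k}\qquad(k=0,\dots,m),$$ and $\Delta\in\mathcal D'$ satisfies: 1. if $M\le n$, then $\Delta=0$; 2. if $M>n$, then $\operatorname{supp}\Delta\subseteq I$ and $\operatorname{ord}\Delta\le M-n$. -/

import Mathlib

open Set Filter Topology MeasureTheory
open scoped ContDiff Distributions

namespace DistODE

/-- Complex-valued test functions: smooth functions `ℝ → ℂ` with compact support. -/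
abbrev Test : Type := TestFunction (⊤ : TopologicalSpace.Opens ℝ) ℂ ⊤

/-- Schwartz distributions on `ℝ`: continuous complex-linear functionals on the test functions
(with their canonical LF topology). -/
abbrev Distr : Type := Test →L[ℂ] ℂ

/-- The regular distribution `t ↦ ∫ t(x) g(x) dx` of a locally integrable function `g`
(the value is `0` if `g` is not locally integrable). -/
noncomputable def reg (g : ℝ → ℂ) : Distr :=
  TestFunction.integralAgainstBilinCLM (ContinuousLinearMap.mul ℂ ℂ) volume g

/-- The distributional derivative `⟨F', t⟩ = -⟨F, t'⟩`. -/
noncomputable def dDeriv (F : Distr) : Distr :=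
  -(F.comp (TestFunction.lineDerivCLM ℂ (1 : ℝ) : Test →L[ℂ] Test))

/-- On the open set `U` the distribution `F` is the (regular distribution of the) function `g`. -/
def EqFunOn (F : Distr) (U : Set ℝ) (g : ℝ → ℂ) : Prop :=
  ∀ t : Test, tsupport t ⊆ U → F t = ∫ x, t x * g x

/-- On the open set `U` the distribution `F` is a smooth function. -/
def SmoothOn (F : Distr) (U : Set ℝ) : Prop :=
  ∃ g : ℝ → ℂ, ContDiffOn ℝ ∞ g U ∧ EqFunOn F U g

/-- The singular support: the complement of the largest open set on which `F` is a smooth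
function. -/
def singSupp (F : Distr) : Set ℝ := (⋃₀ {U : Set ℝ | IsOpen U ∧ SmoothOn F U})ᶜ

/-- The order of a distribution: the least `n` such that `F` is the `n`-th distributional
derivative of a regular distribution (`⊤` if there is no such `n`). With this convention
regular distributions have order `0` and the `j`-th derivative of a Dirac delta has
order `j + 1`. -/
noncomputable def ord (F : Distr) : ℕ∞ :=
  sInf {N : ℕ∞ | ∃ (n : ℕ) (g : ℝ → ℂ), N = n ∧ LocallyIntegrable g volume ∧ F = dDeriv^[n] (reg g)}

/-- Piecewise smooth functions: smooth except on a finite set of points, at which the function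
and all its derivatives have finite left and right limits. -/
def PiecewiseSmooth (g : ℝ → ℂ) : Prop :=
  ∃ S : Finset ℝ, ContDiffOn ℝ ∞ g ((S : Set ℝ)ᶜ) ∧
    ∀ x ∈ S, ∀ k : ℕ,
      (∃ l : ℂ, Tendsto (iteratedDeriv k g) (𝓝[<] x) (𝓝 l)) ∧
      (∃ r : ℂ, Tendsto (iteratedDeriv k g) (𝓝[>] x) (𝓝 r))

/-- The space `𝒜`: piecewise smooth functions, regarded as distributions, together with all their
distributional derivatives of all orders. -/
def 𝒜 : Set Distr := {F | ∃ (k : ℕ) (g : ℝ → ℂ), PiecewiseSmooth g ∧ F = dDeriv^[k] (reg g)}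

/-- The test function `g t` (extended by zero), where `g` is smooth on the open set `U` and the
test function `t` is supported in `U`. -/
noncomputable def mulTest {U : Set ℝ} (hU : IsOpen U) {g : ℝ → ℂ} (hg : ContDiffOn ℝ ∞ g U)
    (t : Test) (ht : tsupport t ⊆ U) : Test where
  toFun x := g x * t x
  contDiff' := by
    rw [contDiff_iff_contDiffAt]
    intro x
    by_cases hx : x ∈ tsupport t
    · exact (hg.contDiffAt (hU.mem_nhds (ht hx))).mul t.contDiff.contDiffAt
    · have h0 : (fun x => g x * t x) =ᶠ[𝓝 x] fun _ => 0 := by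
        filter_upwards [(notMem_tsupport_iff_eventuallyEq.mp hx)] with y hy
        simp [hy]
      exact contDiffAt_const.congr_of_eventuallyEq h0
  hasCompactSupport' := t.hasCompactSupport.mul_left
  tsupport_subset' := by simp

/-- On the open set `U` the distribution `P` is the dual product `⟨F g, t⟩ = ⟨F, g t⟩` of the
distribution `F` by the function `g`, smooth on `U`. -/
def EqDualProdOn (P F : Distr) {U : Set ℝ} (hU : IsOpen U) {g : ℝ → ℂ}
    (hg : ContDiffOn ℝ ∞ g U) : Prop :=
  ∀ (t : Test) (ht : tsupport t ⊆ U), P t = F (mulTest hU hg t ht)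

/-- `P` is the Hörmander product of `F` and `G`: there is a finite open cover of `ℝ` on each member
of which one of the factors is a smooth function and `P` is the dual product of the other
factor by this function. -/
def IsHormanderProd (F G P : Distr) : Prop :=
  ∃ (d : ℕ) (Ξ : Fin d → Set ℝ) (hΞ : ∀ i, IsOpen (Ξ i)), (⋃ i, Ξ i) = univ ∧
    ∀ i, ∃ (g : ℝ → ℂ) (hg : ContDiffOn ℝ ∞ g (Ξ i)),
      (EqFunOn G (Ξ i) g ∧ EqDualProdOn P F (hΞ i) hg) ∨
      (EqFunOn F (Ξ i) g ∧ EqDualProdOn P G (hΞ i) hg)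

open Classical in
/-- The Hörmander product `F · G`. It exists (and is unique) for `F`, `G` in `𝒜` with disjoint
singular supports; the value is `0` where it does not exist. -/
noncomputable def hormander (F G : Distr) : Distr :=
  if h : ∃ P, IsHormanderProd F G P then h.choose else 0

theorem contDiff_translate (ε : ℝ) (t : ℝ → ℂ) (ht : ContDiff ℝ ∞ t) :
    ContDiff ℝ ∞ fun x => t (x - ε) :=
  ht.comp (contDiff_id.sub contDiff_const)

/-- Translation of test functions, `t ↦ t(· - ε)`. -/
noncomputable def translateTest (ε : ℝ) : Test →L[ℂ] Test :=
  TestFunction.limitCLM ℂ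
    (fun t => ⟨fun x => t (x - ε), contDiff_translate ε t t.contDiff,
      t.hasCompactSupport.comp_homeomorph (Homeomorph.subRight ε), by simp⟩)
    (fun K _ =>
      TestFunction.ofSupportedInCLM ℂ (K := K.map (fun x => x + ε) (by fun_prop)) (by simp) ∘L
      ContDiffMapSupportedIn.mkCLM ℂ (fun f x => f (x - ε))
        (fun _ _ _ => rfl) (fun _ _ _ => rfl)
        (fun f => contDiff_translate ε f f.contDiff)
        (fun f x hx => f.zero_on_compl (fun h => hx ⟨x - ε, h, by simp⟩))
        (fun i _ => ⟨{i}, 1, zero_le_one, fun f x _ => by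
          rw [iteratedFDeriv_comp_sub]
          simpa using
            ContDiffMapSupportedIn.norm_iteratedFDeriv_apply_le_seminorm_top ℂ⟩))
    (fun _ _ _ => rfl)

/-- The translated distribution `G(x + ε)`, i.e. `⟨G(x + ε), t⟩ = ⟨G, t(x - ε)⟩`. -/
noncomputable def shiftDistr (ε : ℝ) (G : Distr) : Distr := G.comp (translateTest ε)

/-- `P` is the limit of `F(x) · G(x + ε)` for `ε ↓ 0`, in the sense of distributions. -/
def IsStarProd (F G P : Distr) : Prop :=
  ∀ t : Test, Tendsto (fun ε : ℝ => hormander F (shiftDistr ε G) t) (𝓝[>] 0) (𝓝 (P t))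

open Classical in
/-- The product `F * G = lim_{ε ↓ 0} F(x) · G(x + ε)`. It exists for all `F`, `G` in `𝒜`; the value
is `0` where the limit does not exist. -/
noncomputable def starProd (F G : Distr) : Distr :=
  if h : ∃ P, IsStarProd F G P then h.choose else 0

infixl:70 " ⋆ " => starProd

/-- `ψ ∈ 𝒜` is a solution of `∑_{i=0}^n (a_i ⋆ ψ^{(i)} + ψ^{(i)} ⋆ b_i) = f` in the sense of
distributions. -/
def IsSolution {n : ℕ} (a b : Fin (n + 1) → Distr) (f : ℝ → ℂ) (ψ : Distr) : Prop :=
  ψ ∈ 𝒜 ∧ ∑ i : Fin (n + 1), (a i ⋆ (dDeriv^[(i : ℕ)] ψ) + (dDeriv^[(i : ℕ)] ψ) ⋆ b i) = reg f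

/-- The singular set of the equation. -/
def singularSet {n : ℕ} (a b : Fin (n + 1) → Distr) : Set ℝ :=
  ⋃ i, singSupp (a i) ∪ singSupp (b i)

/-- The maximal order of the coefficients. -/
noncomputable def maxOrd {n : ℕ} (a b : Fin (n + 1) → Distr) : ℕ∞ :=
  Finset.univ.sup fun i => max (ord (a i)) (ord (b i))

/-- `g`, smooth on the closure of the open interval `Ω`, is the extension to this closure of the
restriction `F|_Ω`. -/
def IsSmoothExt (F : Distr) (Ω : Set ℝ) (g : ℝ → ℂ) : Prop :=
  ContDiffOn ℝ ∞ g (closure Ω) ∧ EqFunOn F Ω g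

/-- The left lateral value `F(x⁻) = c`: on some interval `(y, x)` the distribution `F` is a smooth
function with limit `c` at `x`. -/
def IsLeftValue (F : Distr) (x : ℝ) (c : ℂ) : Prop :=
  ∃ y < x, ∃ g : ℝ → ℂ, ContDiffOn ℝ ∞ g (Ioo y x) ∧ EqFunOn F (Ioo y x) g ∧
    Tendsto g (𝓝[<] x) (𝓝 c)

/-- The right lateral value `F(x⁺) = c`. -/
def IsRightValue (F : Distr) (x : ℝ) (c : ℂ) : Prop :=
  ∃ y > x, ∃ g : ℝ → ℂ, ContDiffOn ℝ ∞ g (Ioo x y) ∧ EqFunOn F (Ioo x y) g ∧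
    Tendsto g (𝓝[>] x) (𝓝 c)

/-- For `ξ_1 < ⋯ < ξ_m` (here indexed from `0`), the interval `Ω_k = (ξ_k, ξ_{k+1})`, `k = 0, …, m`,
where `ξ_0 = -∞` and `ξ_{m+1} = +∞`: the points with exactly the first `k` of the `ξ` on their
left and the others on their right. -/
def gap {m : ℕ} (ξ : Fin m → ℝ) (k : Fin (m + 1)) : Set ℝ :=
  {x | (∀ j : Fin m, (j : ℕ) < k → ξ j < x) ∧ (∀ j : Fin m, (k : ℕ) ≤ j → x < ξ j)}

end DistODE

open DistODE

/-!
Every element of `𝒜` has a normal form (`Rep`): it is the regular distribution of a piecewise smooth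
function `f` plus, at each of finitely many points `x`, a combination of derivatives of the Dirac
delta, encoded by a polynomial `c x`. Differentiation multiplies the polynomial at `x` by `-X` and
adds the jump of `f` at `x` as a constant (`Rep.dDeriv_iterate`).

For small `ε > 0` the singularities of `F` and of the translate of `G` are disjoint, so that their
Hörmander product is explicit, and it is unique by a partition of unity. Letting `ε` tend to `0`
gives the product in normal form (`Rep.starProd_apply`): the function parts are multiplied, the
point part of `F` at `x` is multiplied by the right-sided Taylor coefficients of the function part
of `G`, and the point part of `G` by the left-sided ones of the function part of `F`.

Since a normal form determines its function and its polynomials (`local_vanishing`), the equation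
for `ψ = p + ∑ x, c x` splits (`IsSolution.normalForm`) into the equation for the function `p` and,
at every point `x`, an equation between polynomials in which the point part of the `i`-th derivative
of `ψ` is contracted with the one-sided jet `a_i(x⁻) + b_i(x⁺)`. If `c x ≠ 0` has degree `N`, then
only the term `i = n` has degree `N + n`, with leading coefficient multiplied by
`a_n(x⁻) + b_n(x⁺) ≠ 0`; it has to be cancelled by the point parts of the coefficients, which have
degree less than their order (`Rep.coeff_eq_zero_of_ord_le`), so that `N + n < M`. This is the
estimate of the order of `Δ = ∑ x, c x`.

At a regular point the coefficients have no point part. The same comparison of degrees gives first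
`c x = 0` and then that the derivatives of `p` of order less than `n` do not jump. The higher ones
do not jump either, as is seen by differentiating the equation for `p` on both sides of `x`
(`jump_eq_zero`). Hence `p` extends smoothly to the closure of each of the intervals between the
singular points (`PwSmooth.contDiffOn_jetExt`), and there the equation holds by continuity.
-/

open Set Filter Topology MeasureTheory
open scoped ContDiff Distributions

namespace DistODE

/-! ### Jets and point functionals -/

/-- The sequence of all derivatives of `f` at `x`. -/
noncomputable def jet (f : ℝ → ℂ) (x : ℝ) : ℕ → ℂ := fun k => iteratedDeriv k f x

/-- The Leibniz product of two jets: the jet of a product of functions with jets `u` and `v`. -/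
noncomputable def jetMul (u v : ℕ → ℂ) : ℕ → ℂ := fun k =>
  ∑ i ∈ Finset.range (k + 1), (k.choose i : ℂ) * u i * v (k - i)

/-- The pairing `∑ j, c_j v_j` of a polynomial with a jet. A distribution supported at the single
point `x` is of the form `t ↦ pairing c (jet t x)`, so that polynomials encode combinations of the
derivatives of the Dirac delta at `x` (up to sign, `X ^ j` stands for its `j`-th derivative). -/
noncomputable def pairing (c : Polynomial ℂ) (v : ℕ → ℂ) : ℂ := c.sum fun j a => a * v j

/-- The transpose of the Leibniz product with the jet `u`: the point functional
`t ↦ pairing c (jet (g * t) x)`, where `u` is the jet of `g` at `x`, as a polynomial. -/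
noncomputable def contract (c : Polynomial ℂ) (u : ℕ → ℂ) : Polynomial ℂ :=
  c.sum fun j a => ∑ i ∈ Finset.range (j + 1),
    Polynomial.C (a * (j.choose i : ℂ) * u i) * Polynomial.X ^ (j - i)

@[simp]
theorem pairing_zero (v : ℕ → ℂ) : pairing 0 v = 0 := by simp [pairing]

theorem pairing_add (c d : Polynomial ℂ) (v : ℕ → ℂ) :
    pairing (c + d) v = pairing c v + pairing d v :=
  Polynomial.sum_add_index _ _ _ (by simp) (by intros; ring)

theorem pairing_C_mul_X_pow (a : ℂ) (j : ℕ) (v : ℕ → ℂ) :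
    pairing (Polynomial.C a * Polynomial.X ^ j) v = a * v j := by
  rw [pairing, Polynomial.C_mul_X_pow_eq_monomial, Polynomial.sum_monomial_index _ _ (by simp)]

theorem pairing_C (a : ℂ) (v : ℕ → ℂ) : pairing (Polynomial.C a) v = a * v 0 := by
  simpa using pairing_C_mul_X_pow a 0 v

theorem pairing_sum {ι : Type*} (s : Finset ι) (c : ι → Polynomial ℂ) (v : ℕ → ℂ) :
    pairing (∑ i ∈ s, c i) v = ∑ i ∈ s, pairing (c i) v := by
  classical
  induction s using Finset.induction_on with
  | empty => simp
  | insert i s hi ih => rw [Finset.sum_insert hi, Finset.sum_insert hi, pairing_add, ih]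

theorem pairing_eq_sum (c : Polynomial ℂ) (v : ℕ → ℂ) :
    pairing c v = ∑ j ∈ c.support, c.coeff j * v j := rfl

theorem pairing_neg (c : Polynomial ℂ) (v : ℕ → ℂ) : pairing (-c) v = -pairing c v := by
  rw [eq_neg_iff_add_eq_zero, ← pairing_add]; simp

theorem pairing_X_mul (c : Polynomial ℂ) (v : ℕ → ℂ) :
    pairing (Polynomial.X * c) v = pairing c fun j => v (j + 1) := by
  induction c using Polynomial.induction_on' with
  | add p q hp hq => rw [mul_add, pairing_add, pairing_add, hp, hq]
  | monomial j a =>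
    rw [Polynomial.X_mul_monomial, ← Polynomial.C_mul_X_pow_eq_monomial,
      ← Polynomial.C_mul_X_pow_eq_monomial, pairing_C_mul_X_pow, pairing_C_mul_X_pow]

theorem pairing_single (c : Polynomial ℂ) (k : ℕ) :
    pairing c (fun j => if j = k then 1 else 0) = c.coeff k := by
  rw [pairing_eq_sum]
  simp only [mul_ite, mul_one, mul_zero, Finset.sum_ite_eq', Polynomial.mem_support_iff]
  split_ifs with h
  · rfl
  · exact (not_not.mp h).symm

theorem pairing_zero_right (c : Polynomial ℂ) : pairing c (fun _ => 0) = 0 := by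
  simp [pairing_eq_sum]

theorem pairing_contract (c : Polynomial ℂ) (u v : ℕ → ℂ) :
    pairing (contract c u) v = pairing c (jetMul u v) := by
  rw [contract, Polynomial.sum, pairing_sum, pairing_eq_sum]
  refine Finset.sum_congr rfl fun j _ => ?_
  rw [pairing_sum, jetMul, Finset.mul_sum]
  refine Finset.sum_congr rfl fun i _ => ?_
  rw [pairing_C_mul_X_pow]; ring

@[simp]
theorem contract_zero (u : ℕ → ℂ) : contract 0 u = 0 := by simp [contract]

theorem contract_add_right (c : Polynomial ℂ) (u v : ℕ → ℂ) :
    contract c (u + v) = contract c u + contract c v := by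
  simp only [contract, Polynomial.sum, ← Finset.sum_add_distrib, Pi.add_apply, mul_add, map_add,
    add_mul]

/-- Contraction with `u` multiplies the top coefficient by `u 0`. -/
theorem coeff_contract {c : Polynomial ℂ} {m : ℕ} (hc : c.natDegree ≤ m) (u : ℕ → ℂ) :
    (contract c u).coeff m = c.coeff m * u 0 := by
  have key : ∀ j ∈ c.support, (∑ i ∈ Finset.range (j + 1),
      Polynomial.C (c.coeff j * (j.choose i : ℂ) * u i) * Polynomial.X ^ (j - i)).coeff m =
        if j = m then c.coeff m * u 0 else 0 := by
    intro j hj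
    have hjm : j ≤ m := (Polynomial.le_natDegree_of_mem_supp j hj).trans hc
    rw [Polynomial.finsetSum_coeff]
    simp only [Polynomial.coeff_C_mul, Polynomial.coeff_X_pow]
    split_ifs with h
    · subst h
      rw [Finset.sum_eq_single 0]
      · simp
      · intro i hi hi0
        have : i < j + 1 := Finset.mem_range.mp hi
        rw [if_neg (by lia)]; simp
      · simp
    · refine Finset.sum_eq_zero fun i _ => ?_
      rw [if_neg (by lia)]; simp
  rw [contract, Polynomial.sum, Polynomial.finsetSum_coeff, Finset.sum_congr rfl key,
    Finset.sum_ite_eq']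
  split_ifs with h
  · rfl
  · rw [Polynomial.notMem_support_iff.mp h, zero_mul]

theorem coeff_contract_eq_zero {c : Polynomial ℂ} {M : ℕ} (hc : ∀ j, M ≤ j → c.coeff j = 0)
    (u : ℕ → ℂ) {m : ℕ} (hm : M ≤ m) : (contract c u).coeff m = 0 := by
  have : c.natDegree ≤ m := Polynomial.natDegree_le_iff_coeff_eq_zero.mpr fun N hN =>
    hc N (hm.trans hN.le)
  rw [coeff_contract this, hc m hm, zero_mul]

theorem jet_mul {f g : ℝ → ℂ} {x : ℝ} (hf : ContDiffAt ℝ ∞ f x) (hg : ContDiffAt ℝ ∞ g x) :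
    jet (fun y => f y * g y) x = jetMul (jet f x) (jet g x) := by
  funext k
  exact iteratedDeriv_mul (hf.of_le (by exact_mod_cast le_top))
    (hg.of_le (by exact_mod_cast le_top))

theorem jet_congr {f g : ℝ → ℂ} {x : ℝ} (h : f =ᶠ[𝓝 x] g) : jet f x = jet g x :=
  funext fun k => h.iteratedDeriv_eq k

theorem tendsto_pairing {ι : Type*} {l : Filter ι} {v : ι → ℕ → ℂ} {w : ℕ → ℂ}
    (h : ∀ k, Tendsto (fun i => v i k) l (𝓝 (w k))) (c : Polynomial ℂ) :
    Tendsto (fun i => pairing c (v i)) l (𝓝 (pairing c w)) :=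
  tendsto_finsetSum _ fun j _ => (h j).const_mul _

theorem tendsto_jetMul {ι : Type*} {l : Filter ι} {u v : ι → ℕ → ℂ} {u' v' : ℕ → ℂ}
    (hu : ∀ k, Tendsto (fun i => u i k) l (𝓝 (u' k)))
    (hv : ∀ k, Tendsto (fun i => v i k) l (𝓝 (v' k))) (k : ℕ) :
    Tendsto (fun i => jetMul (u i) (v i) k) l (𝓝 (jetMul u' v' k)) :=
  tendsto_finsetSum _ fun j _ => ((hu j).const_mul _).mul (hv _)

/-! ### The recursion for the point parts of the derivatives -/

/-- The polynomials of the point functionals at a given point of the successive derivatives of a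
distribution, where `J i` is the jump at this point of the `i`-th derivative of its function part
and `D 0` is the polynomial of the distribution itself. -/
def IsDerivSeq (D : ℕ → Polynomial ℂ) (J : ℕ → ℂ) : Prop :=
  ∀ i, D (i + 1) = -(Polynomial.X * D i) + Polynomial.C (J i)

theorem IsDerivSeq.coeff_add {D : ℕ → Polynomial ℂ} {J : ℕ → ℂ} (h : IsDerivSeq D J) {s N : ℕ}
    (hN : (D s).natDegree ≤ N) (q : ℕ) :
    (D (s + q)).natDegree ≤ N + q ∧ (D (s + q)).coeff (N + q) = (-1) ^ q * (D s).coeff N := by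
  induction q with
  | zero => simpa using hN
  | succ q ih =>
    rw [← add_assoc, h]
    constructor
    · refine (Polynomial.natDegree_add_le _ _).trans (max_le ?_ (by simp))
      rw [Polynomial.natDegree_neg]
      refine (Polynomial.natDegree_mul_le).trans ?_
      rw [Polynomial.natDegree_X]
      lia
    · rw [← add_assoc, Polynomial.coeff_add, Polynomial.coeff_neg, Polynomial.coeff_X_mul, ih.2,
        Polynomial.coeff_C_of_ne_zero (by lia)]
      ring

/-- The key step of the order estimate: in the sum of the products the top coefficient of `D n` is
multiplied by `w n 0`, and no other term contributes in this degree. -/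
theorem IsDerivSeq.coeff_eq_zero {D : ℕ → Polynomial ℂ} {J : ℕ → ℂ} (h : IsDerivSeq D J)
    {n s N M : ℕ} {w : ℕ → ℕ → ℂ} {E : Polynomial ℂ}
    (heq : ∑ i ∈ Finset.range (n + 1), contract (D i) (w i) + E = 0)
    (hE : ∀ j, M ≤ j → E.coeff j = 0) (hw : w n 0 ≠ 0) (hs : s ≤ n) (h0 : ∀ i < s, D i = 0)
    (hN : (D s).natDegree ≤ N) (hM : M ≤ N + (n - s)) : (D s).coeff N = 0 := by
  have h1 := congrArg (fun p => Polynomial.coeff p (N + (n - s))) heq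
  simp only [Polynomial.coeff_add, hE _ hM, add_zero, Polynomial.coeff_zero,
    Polynomial.finsetSum_coeff] at h1
  rw [Finset.sum_range_succ, Finset.sum_eq_zero, zero_add] at h1
  · have h2 := h.coeff_add hN (n - s)
    rw [Nat.add_sub_cancel' hs] at h2
    rw [coeff_contract h2.1, h2.2] at h1
    simpa [hw] using h1
  · intro i hi
    have hin : i < n := Finset.mem_range.mp hi
    rcases lt_or_ge i s with his | his
    · simp [h0 i his]
    · have h2 := (h.coeff_add hN (i - s)).1
      rw [Nat.add_sub_cancel' his] at h2
      refine coeff_contract_eq_zero (M := N + (i - s) + 1) (fun j hj => ?_) _ (by lia)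
      exact Polynomial.coeff_eq_zero_of_natDegree_lt (by lia)

/-- The point functional `D 0` has degree less than `M - n` if the inhomogeneity `E` has degree less
than `M`. -/
theorem IsDerivSeq.coeff_zero_of_le {D : ℕ → Polynomial ℂ} {J : ℕ → ℂ} (h : IsDerivSeq D J)
    {n M : ℕ} {w : ℕ → ℕ → ℂ} {E : Polynomial ℂ}
    (heq : ∑ i ∈ Finset.range (n + 1), contract (D i) (w i) + E = 0)
    (hE : ∀ j, M ≤ j → E.coeff j = 0) (hw : w n 0 ≠ 0) {j : ℕ} (hj : M ≤ j + n) :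
    (D 0).coeff j = 0 := by
  by_contra hne
  have h1 : j ≤ (D 0).natDegree := Polynomial.le_natDegree_of_ne_zero hne
  have h2 := h.coeff_eq_zero heq hE hw (Nat.zero_le n) (by simp) le_rfl (by lia)
  rw [Polynomial.coeff_natDegree, Polynomial.leadingCoeff_eq_zero] at h2
  simp [h2] at hne

/-- For `E = 0` the point parts vanish one after the other. This holds for `D 0` by the degree bound;
a later one `D i`, if it were the first that does not vanish, would be the constant `J (i - 1)`, and the term `D n` alone contains its derivative of order `n - i`. -/
theorem IsDerivSeq.jump_eq_zero {D : ℕ → Polynomial ℂ} {J : ℕ → ℂ} (h : IsDerivSeq D J)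
    {n : ℕ} {w : ℕ → ℕ → ℂ}
    (heq : ∑ i ∈ Finset.range (n + 1), contract (D i) (w i) = 0) (hw : w n 0 ≠ 0) {i : ℕ}
    (hi : i ≤ n) : D i = 0 := by
  induction i using Nat.strong_induction_on with
  | _ i ih =>
    rcases i with _ | i
    · refine Polynomial.ext fun j => ?_
      exact h.coeff_zero_of_le (E := 0) (M := 0) (by simpa using heq) (by simp) hw (by lia)
    · have h1 : D (i + 1) = Polynomial.C (J i) := by
        rw [h, ih i (by lia) (by lia)]; simp
      have h2 := h.coeff_eq_zero (E := 0) (M := 0) (N := 0) (by simpa using heq) (by simp) hw hi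
        (fun k hk => ih k hk (by lia)) (by rw [h1]; simp) (by lia)
      rw [h1] at h2 ⊢
      simpa using h2

section

/-! ### Piecewise smooth functions and their one-sided jets -/

/-- `f` is piecewise smooth with exceptional set `S`: it is smooth off the finite set `S`, and all
its derivatives have one-sided limits everywhere. The values of `f` on `S` are irrelevant. -/
structure PwSmooth (S : Finset ℝ) (f : ℝ → ℂ) : Prop where
  smooth : ContDiffOn ℝ ∞ f ((S : Set ℝ)ᶜ)
  left : ∀ (x : ℝ) (k : ℕ), ∃ l : ℂ, Tendsto (iteratedDeriv k f) (𝓝[<] x) (𝓝 l)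
  right : ∀ (x : ℝ) (k : ℕ), ∃ l : ℂ, Tendsto (iteratedDeriv k f) (𝓝[>] x) (𝓝 l)

/-- The left limits at `x` of all derivatives of `f`. -/
noncomputable def leftJet (f : ℝ → ℂ) (x : ℝ) (k : ℕ) : ℂ :=
  limUnder (𝓝[<] x) (iteratedDeriv k f)

/-- The right limits at `x` of all derivatives of `f`. -/
noncomputable def rightJet (f : ℝ → ℂ) (x : ℝ) (k : ℕ) : ℂ :=
  limUnder (𝓝[>] x) (iteratedDeriv k f)

variable {S T : Finset ℝ} {f g : ℝ → ℂ}

theorem isOpen_compl_finset (S : Finset ℝ) : IsOpen ((S : Set ℝ)ᶜ) :=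
  S.finite_toSet.isClosed.isOpen_compl

theorem eventually_left_notMem (S : Finset ℝ) (x : ℝ) : ∀ᶠ y in 𝓝[<] x, y ∉ S := by
  have h : ((S : Set ℝ) \ {x})ᶜ ∈ 𝓝 x :=
    (S.finite_toSet.subset sdiff_subset).isClosed.isOpen_compl.mem_nhds (by simp)
  filter_upwards [mem_nhdsWithin_of_mem_nhds h, self_mem_nhdsWithin] with y hy hyx hS
  exact hy ⟨hS, (ne_of_lt hyx)⟩

theorem eventually_right_notMem (S : Finset ℝ) (x : ℝ) : ∀ᶠ y in 𝓝[>] x, y ∉ S := by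
  have h : ((S : Set ℝ) \ {x})ᶜ ∈ 𝓝 x :=
    (S.finite_toSet.subset sdiff_subset).isClosed.isOpen_compl.mem_nhds (by simp)
  filter_upwards [mem_nhdsWithin_of_mem_nhds h, self_mem_nhdsWithin] with y hy hyx hS
  exact hy ⟨hS, (ne_of_gt hyx)⟩

namespace PwSmooth

theorem tendsto_left (hf : PwSmooth S f) (x : ℝ) (k : ℕ) :
    Tendsto (iteratedDeriv k f) (𝓝[<] x) (𝓝 (leftJet f x k)) :=
  tendsto_nhds_limUnder (hf.left x k)

theorem tendsto_right (hf : PwSmooth S f) (x : ℝ) (k : ℕ) :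
    Tendsto (iteratedDeriv k f) (𝓝[>] x) (𝓝 (rightJet f x k)) :=
  tendsto_nhds_limUnder (hf.right x k)

theorem contDiffAt (hf : PwSmooth S f) {x : ℝ} (hx : x ∉ S) : ContDiffAt ℝ ∞ f x :=
  hf.smooth.contDiffAt ((isOpen_compl_finset S).mem_nhds (by simpa using hx))

end PwSmooth

theorem contDiffAt_iteratedDeriv {x : ℝ} (hf : ContDiffAt ℝ ∞ f x) (k : ℕ) :
    ContDiffAt ℝ ∞ (iteratedDeriv k f) x := by
  induction k with
  | zero => simpa using hf
  | succ k ih =>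
    rw [iteratedDeriv_succ]
    exact (ih.fderiv_right (m := ∞) (by simp)).clm_apply contDiffAt_const

theorem tendsto_iteratedDeriv {x : ℝ} (hf : ContDiffAt ℝ ∞ f x) (k : ℕ) :
    Tendsto (iteratedDeriv k f) (𝓝 x) (𝓝 (iteratedDeriv k f x)) :=
  (contDiffAt_iteratedDeriv hf k).continuousAt

theorem hasDerivAt_iteratedDeriv {x : ℝ} (hf : ContDiffAt ℝ ∞ f x) (k : ℕ) :
    HasDerivAt (iteratedDeriv k f) (iteratedDeriv (k + 1) f x) x := by
  rw [iteratedDeriv_succ]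
  exact ((contDiffAt_iteratedDeriv hf k).differentiableAt (by simp)).hasDerivAt

theorem leftJet_eq_of_contDiffAt {x : ℝ} (hf : ContDiffAt ℝ ∞ f x) : leftJet f x = jet f x :=
  funext fun k => ((tendsto_iteratedDeriv hf k).mono_left nhdsWithin_le_nhds).limUnder_eq

theorem rightJet_eq_of_contDiffAt {x : ℝ} (hf : ContDiffAt ℝ ∞ f x) : rightJet f x = jet f x :=
  funext fun k => ((tendsto_iteratedDeriv hf k).mono_left nhdsWithin_le_nhds).limUnder_eq

theorem eventuallyEq_iteratedDeriv_left {x : ℝ} (h : f =ᶠ[𝓝[<] x] g) (k : ℕ) :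
    iteratedDeriv k f =ᶠ[𝓝[<] x] iteratedDeriv k g := by
  filter_upwards [eventually_eventually_nhdsWithin.mpr h, self_mem_nhdsWithin] with y hy hyx
  rw [isOpen_Iio.nhdsWithin_eq hyx] at hy
  exact Filter.EventuallyEq.iteratedDeriv_eq k hy

theorem eventuallyEq_iteratedDeriv_right {x : ℝ} (h : f =ᶠ[𝓝[>] x] g) (k : ℕ) :
    iteratedDeriv k f =ᶠ[𝓝[>] x] iteratedDeriv k g := by
  filter_upwards [eventually_eventually_nhdsWithin.mpr h, self_mem_nhdsWithin] with y hy hyx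
  rw [isOpen_Ioi.nhdsWithin_eq hyx] at hy
  exact Filter.EventuallyEq.iteratedDeriv_eq k hy

theorem leftJet_congr {x : ℝ} (h : f =ᶠ[𝓝[<] x] g) : leftJet f x = leftJet g x := by
  funext k
  rw [leftJet, leftJet, limUnder, limUnder, map_congr (eventuallyEq_iteratedDeriv_left h k)]

theorem rightJet_congr {x : ℝ} (h : f =ᶠ[𝓝[>] x] g) : rightJet f x = rightJet g x := by
  funext k
  rw [rightJet, rightJet, limUnder, limUnder, map_congr (eventuallyEq_iteratedDeriv_right h k)]

theorem iteratedDeriv_add_iteratedDeriv (f : ℝ → ℂ) (i k : ℕ) :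
    iteratedDeriv k (iteratedDeriv i f) = iteratedDeriv (k + i) f := by
  simp only [iteratedDeriv_eq_iterate, Function.iterate_add_apply]

theorem leftJet_iteratedDeriv (f : ℝ → ℂ) (x : ℝ) (i k : ℕ) :
    leftJet (iteratedDeriv i f) x k = leftJet f x (k + i) := by
  simp only [leftJet, iteratedDeriv_add_iteratedDeriv]

theorem rightJet_iteratedDeriv (f : ℝ → ℂ) (x : ℝ) (i k : ℕ) :
    rightJet (iteratedDeriv i f) x k = rightJet f x (k + i) := by
  simp only [rightJet, iteratedDeriv_add_iteratedDeriv]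

namespace PwSmooth

theorem mono (hf : PwSmooth S f) (h : S ⊆ T) : PwSmooth T f :=
  ⟨hf.smooth.mono (compl_subset_compl.mpr (by exact_mod_cast h)), hf.left, hf.right⟩

theorem pwSmooth_iteratedDeriv (hf : PwSmooth S f) (i : ℕ) : PwSmooth S (iteratedDeriv i f) where
  smooth x hx := (contDiffAt_iteratedDeriv (hf.contDiffAt (by simpa using hx)) i).contDiffWithinAt
  left x k := by rw [iteratedDeriv_add_iteratedDeriv]; exact hf.left x _
  right x k := by rw [iteratedDeriv_add_iteratedDeriv]; exact hf.right x _

theorem of_contDiff (hf : ContDiff ℝ ∞ f) : PwSmooth S f where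
  smooth := hf.contDiffOn
  left _ k := ⟨_, (tendsto_iteratedDeriv hf.contDiffAt k).mono_left nhdsWithin_le_nhds⟩
  right _ k := ⟨_, (tendsto_iteratedDeriv hf.contDiffAt k).mono_left nhdsWithin_le_nhds⟩

theorem eventually_jet_mul_left (hf : PwSmooth S f) (hg : PwSmooth S g) (x : ℝ) :
    ∀ᶠ y in 𝓝[<] x, jet (fun z => f z * g z) y = jetMul (jet f y) (jet g y) := by
  filter_upwards [eventually_left_notMem S x] with y hy
  exact jet_mul (hf.contDiffAt hy) (hg.contDiffAt hy)

theorem eventually_jet_mul_right (hf : PwSmooth S f) (hg : PwSmooth S g) (x : ℝ) :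
    ∀ᶠ y in 𝓝[>] x, jet (fun z => f z * g z) y = jetMul (jet f y) (jet g y) := by
  filter_upwards [eventually_right_notMem S x] with y hy
  exact jet_mul (hf.contDiffAt hy) (hg.contDiffAt hy)

theorem tendsto_left_mul (hf : PwSmooth S f) (hg : PwSmooth S g) (x : ℝ) (k : ℕ) :
    Tendsto (iteratedDeriv k fun z => f z * g z) (𝓝[<] x)
      (𝓝 (jetMul (leftJet f x) (leftJet g x) k)) := by
  refine (tendsto_jetMul (hf.tendsto_left x) (hg.tendsto_left x) k).congr' ?_
  filter_upwards [hf.eventually_jet_mul_left hg x] with y hy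
  exact (congrFun hy k).symm

theorem tendsto_right_mul (hf : PwSmooth S f) (hg : PwSmooth S g) (x : ℝ) (k : ℕ) :
    Tendsto (iteratedDeriv k fun z => f z * g z) (𝓝[>] x)
      (𝓝 (jetMul (rightJet f x) (rightJet g x) k)) := by
  refine (tendsto_jetMul (hf.tendsto_right x) (hg.tendsto_right x) k).congr' ?_
  filter_upwards [hf.eventually_jet_mul_right hg x] with y hy
  exact (congrFun hy k).symm

theorem mul (hf : PwSmooth S f) (hg : PwSmooth S g) : PwSmooth S fun x => f x * g x where
  smooth := hf.smooth.mul hg.smooth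
  left x k := ⟨_, hf.tendsto_left_mul hg x k⟩
  right x k := ⟨_, hf.tendsto_right_mul hg x k⟩

theorem leftJet_mul (hf : PwSmooth S f) (hg : PwSmooth S g) (x : ℝ) :
    leftJet (fun z => f z * g z) x = jetMul (leftJet f x) (leftJet g x) :=
  funext fun k => (hf.tendsto_left_mul hg x k).limUnder_eq

theorem rightJet_mul (hf : PwSmooth S f) (hg : PwSmooth S g) (x : ℝ) :
    rightJet (fun z => f z * g z) x = jetMul (rightJet f x) (rightJet g x) :=
  funext fun k => (hf.tendsto_right_mul hg x k).limUnder_eq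

theorem tendsto_left_add (hf : PwSmooth S f) (hg : PwSmooth S g) (x : ℝ) (k : ℕ) :
    Tendsto (iteratedDeriv k fun z => f z + g z) (𝓝[<] x)
      (𝓝 (leftJet f x k + leftJet g x k)) := by
  refine ((hf.tendsto_left x k).add (hg.tendsto_left x k)).congr' ?_
  filter_upwards [eventually_left_notMem S x] with y hy
  exact (iteratedDeriv_fun_add ((hf.contDiffAt hy).of_le (by exact_mod_cast le_top))
    ((hg.contDiffAt hy).of_le (by exact_mod_cast le_top))).symm

theorem tendsto_right_add (hf : PwSmooth S f) (hg : PwSmooth S g) (x : ℝ) (k : ℕ) :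
    Tendsto (iteratedDeriv k fun z => f z + g z) (𝓝[>] x)
      (𝓝 (rightJet f x k + rightJet g x k)) := by
  refine ((hf.tendsto_right x k).add (hg.tendsto_right x k)).congr' ?_
  filter_upwards [eventually_right_notMem S x] with y hy
  exact (iteratedDeriv_fun_add ((hf.contDiffAt hy).of_le (by exact_mod_cast le_top))
    ((hg.contDiffAt hy).of_le (by exact_mod_cast le_top))).symm

theorem add (hf : PwSmooth S f) (hg : PwSmooth S g) : PwSmooth S fun x => f x + g x where
  smooth := hf.smooth.add hg.smooth
  left x k := ⟨_, hf.tendsto_left_add hg x k⟩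
  right x k := ⟨_, hf.tendsto_right_add hg x k⟩

theorem leftJet_add (hf : PwSmooth S f) (hg : PwSmooth S g) (x : ℝ) :
    leftJet (fun z => f z + g z) x = leftJet f x + leftJet g x :=
  funext fun k => (hf.tendsto_left_add hg x k).limUnder_eq

theorem rightJet_add (hf : PwSmooth S f) (hg : PwSmooth S g) (x : ℝ) :
    rightJet (fun z => f z + g z) x = rightJet f x + rightJet g x :=
  funext fun k => (hf.tendsto_right_add hg x k).limUnder_eq

theorem sum {ι : Type*} {s : Finset ι} {F : ι → ℝ → ℂ} (h : ∀ i ∈ s, PwSmooth S (F i)) :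
    PwSmooth S (fun x => ∑ i ∈ s, F i x) ∧
      (∀ x, leftJet (fun x => ∑ i ∈ s, F i x) x = ∑ i ∈ s, leftJet (F i) x) ∧
      ∀ x, rightJet (fun x => ∑ i ∈ s, F i x) x = ∑ i ∈ s, rightJet (F i) x := by
  classical
  induction s using Finset.induction_on with
  | empty =>
    have h0 : ContDiff ℝ ∞ fun _ : ℝ => (0 : ℂ) := contDiff_const
    have h1 : ∀ x, jet (fun _ : ℝ => (0 : ℂ)) x = 0 := fun x => by
      funext k; simp [jet]
    simp only [Finset.sum_empty]
    exact ⟨of_contDiff h0, fun x => by rw [leftJet_eq_of_contDiffAt h0.contDiffAt, h1],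
      fun x => by rw [rightJet_eq_of_contDiffAt h0.contDiffAt, h1]⟩
  | insert i s hi ih =>
    obtain ⟨h1, h2, h3⟩ := ih fun j hj => h j (Finset.mem_insert_of_mem hj)
    have hF := h i (Finset.mem_insert_self i s)
    simp only [Finset.sum_insert hi]
    exact ⟨hF.add h1, fun x => by rw [hF.leftJet_add h1, h2],
      fun x => by rw [hF.rightJet_add h1, h3]⟩

theorem eventually_norm_le (hf : PwSmooth S f) (x : ℝ) : ∃ C : ℝ, ∀ᶠ y in 𝓝 x, ‖f y‖ ≤ C := by
  have hl := (hf.tendsto_left x 0).norm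
  have hr := (hf.tendsto_right x 0).norm
  rw [iteratedDeriv_zero] at hl hr
  refine ⟨max (max (‖leftJet f x 0‖ + 1) (‖rightJet f x 0‖ + 1)) ‖f x‖, ?_⟩
  rw [← nhdsNE_sup_pure, ← Iio_union_Ioi, nhdsWithin_union, eventually_sup, eventually_sup]
  refine ⟨⟨?_, ?_⟩, by simp⟩
  · filter_upwards [hl.eventually_lt_const (lt_add_one _)] with y hy
    exact hy.le.trans ((le_max_left _ _).trans (le_max_left _ _))
  · filter_upwards [hr.eventually_lt_const (lt_add_one _)] with y hy
    exact hy.le.trans ((le_max_right _ _).trans (le_max_left _ _))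

theorem exists_bound (hf : PwSmooth S f) {K : Set ℝ} (hK : IsCompact K) :
    ∃ C : ℝ, ∀ x ∈ K, ‖f x‖ ≤ C := by
  refine hK.induction_on (p := fun s => ∃ C : ℝ, ∀ x ∈ s, ‖f x‖ ≤ C) ⟨0, by simp⟩
    (fun s t hst ⟨C, hC⟩ => ⟨C, fun x hx => hC x (hst hx)⟩) ?_ fun x _ => ?_
  · rintro s t ⟨C, hC⟩ ⟨C', hC'⟩
    exact ⟨max C C', fun x hx => hx.elim (fun h => (hC x h).trans (le_max_left _ _))
      fun h => (hC' x h).trans (le_max_right _ _)⟩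
  · obtain ⟨C, hC⟩ := hf.eventually_norm_le x
    exact ⟨_, mem_nhdsWithin_of_mem_nhds hC, C, fun y hy => hy⟩

theorem aestronglyMeasurable (hf : PwSmooth S f) : AEStronglyMeasurable f volume := by
  have h1 : AEStronglyMeasurable f (volume.restrict (S : Set ℝ)ᶜ) :=
    hf.smooth.continuousOn.aestronglyMeasurable (isOpen_compl_finset S).measurableSet
  rwa [Measure.restrict_eq_self_of_ae_mem] at h1
  exact S.finite_toSet.countable.ae_notMem volume

theorem locallyIntegrable (hf : PwSmooth S f) : LocallyIntegrable f volume := by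
  rw [locallyIntegrable_iff]
  intro K hK
  obtain ⟨C, hC⟩ := hf.exists_bound hK
  exact Measure.integrableOn_of_bounded hK.measure_lt_top.ne hf.aestronglyMeasurable
    (ae_restrict_of_forall_mem hK.measurableSet hC)

end PwSmooth

theorem PiecewiseSmooth.exists_pwSmooth (h : PiecewiseSmooth f) : ∃ S, PwSmooth S f := by
  obtain ⟨S, h1, h2⟩ := h
  have h3 : ∀ x ∉ S, ContDiffAt ℝ ∞ f x := fun x hx =>
    h1.contDiffAt ((isOpen_compl_finset S).mem_nhds (by simpa using hx))
  refine ⟨S, h1, fun x k => ?_, fun x k => ?_⟩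
  · by_cases hx : x ∈ S
    · exact (h2 x hx k).1
    · exact ⟨_, (tendsto_iteratedDeriv (h3 x hx) k).mono_left nhdsWithin_le_nhds⟩
  · by_cases hx : x ∈ S
    · exact (h2 x hx k).2
    · exact ⟨_, (tendsto_iteratedDeriv (h3 x hx) k).mono_left nhdsWithin_le_nhds⟩

end

section

variable {S T : Finset ℝ} {f g : ℝ → ℂ}

/-! ### Regular distributions and derivatives -/

theorem reg_apply (hg : LocallyIntegrable g volume) (t : Test) : reg g t = ∫ x, t x * g x := by
  rw [reg, TestFunction.integralAgainstBilinCLM_eq_integral (hg.locallyIntegrableOn _)]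
  rfl

theorem Test.integrable_mul (t : Test) (hg : LocallyIntegrable g volume) :
    Integrable (fun x => t x * g x) volume :=
  TestFunction.integrable_bilin (ContinuousLinearMap.mul ℂ ℂ) (hg.locallyIntegrableOn _) t

theorem Test.contDiff (t : Test) : ContDiff ℝ ∞ t := TestFunction.contDiff t

/-- The derivative of a test function. -/
noncomputable def Test.deriv (t : Test) : Test := TestFunction.lineDerivCLM ℂ (1 : ℝ) t

theorem Test.coe_deriv (t : Test) : ⇑t.deriv = _root_.deriv t := by
  funext x
  rw [Test.deriv, TestFunction.lineDerivCLM_apply_of_le (by simp), lineDeriv]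
  have h : (fun s : ℝ => t (x + s • (1 : ℝ))) = fun s : ℝ => t (x + s) := by simp
  rw [h, deriv_comp_const_add, add_zero]

theorem dDeriv_apply (F : Distr) (t : Test) : dDeriv F t = -F t.deriv := rfl

theorem jet_deriv (t : Test) (x : ℝ) : jet t.deriv x = fun j => jet t x (j + 1) := by
  funext j
  simp only [jet, Test.coe_deriv, iteratedDeriv_succ']

theorem Test.hasDerivAt (t : Test) (x : ℝ) : HasDerivAt t (t.deriv x) x := by
  rw [Test.coe_deriv]
  exact (t.contDiff.differentiable (by simp) x).hasDerivAt

theorem jet_zero (f : ℝ → ℂ) (x : ℝ) : jet f x 0 = f x := by simp [jet]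

theorem jet_eq_zero {x : ℝ} (hx : x ∉ tsupport f) : jet f x = 0 := by
  rw [jet_congr (notMem_tsupport_iff_eventuallyEq.mp hx)]
  funext k
  have h : iteratedDeriv k (fun _ : ℝ => (0 : ℂ)) x = 0 := by simp
  exact h

/-- The fundamental theorem of calculus for a piecewise smooth function with compact support: the
integral of its derivative is minus the sum of its jumps. -/
theorem PwSmooth.integral_deriv (hf : PwSmooth S f) (hc : HasCompactSupport f) :
    ∫ x, deriv f x = -∑ x ∈ S, (rightJet f x 0 - leftJet f x 0) := by
  classical
  set J : ℝ → ℂ := fun x => rightJet f x 0 - leftJet f x 0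
  -- `f`, made continuous by the subtraction of its jumps
  set h : ℝ → ℂ := fun y => (if y ∈ S then leftJet f y 0 else f y) -
    ∑ x ∈ S, if x < y then J x else 0 with hh
  obtain ⟨R, hR0, hR⟩ : ∃ R > 0, tsupport f ∪ S ⊆ Ioo (-R) R := by
    have hb : Bornology.IsBounded (tsupport f ∪ S) :=
      hc.isBounded.union S.finite_toSet.isBounded
    obtain ⟨R, hR0, hR⟩ := hb.subset_ball_lt 0 0
    exact ⟨R, hR0, by simpa [Real.ball_eq_Ioo] using hR⟩
  have hfl := fun y => hf.tendsto_left y 0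
  have hfr := fun y => hf.tendsto_right y 0
  simp only [iteratedDeriv_zero] at hfl hfr
  have hcont : Continuous h := by
    refine continuous_iff_continuousAt.mpr fun y => ?_
    refine continuousAt_iff_continuous_left'_right'.mpr ⟨?_, ?_⟩
    · have h1 : Tendsto (fun z => (if z ∈ S then leftJet f z 0 else f z)) (𝓝[<] y)
          (𝓝 (if y ∈ S then leftJet f y 0 else f y)) := by
        have : (if y ∈ S then leftJet f y 0 else f y) = leftJet f y 0 := by
          split_ifs with hy
          · rfl
          · rw [leftJet_eq_of_contDiffAt (hf.contDiffAt hy), jet_zero]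
        rw [this]
        refine (hfl y).congr' ?_
        filter_upwards [eventually_left_notMem S y] with z hz
        rw [if_neg hz]
      refine h1.sub (tendsto_finsetSum _ fun x _ => ?_)
      refine tendsto_const_nhds.congr' ?_
      by_cases hxy : x < y
      · filter_upwards [mem_nhdsWithin_of_mem_nhds (lt_mem_nhds hxy)] with z hz
        rw [if_pos hxy, if_pos hz]
      · filter_upwards [self_mem_nhdsWithin] with z hz
        rw [if_neg hxy, if_neg]
        exact fun hxz => hxy (hxz.trans hz)
    · have h1 : Tendsto (fun z => (if z ∈ S then leftJet f z 0 else f z)) (𝓝[>] y)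
          (𝓝 (rightJet f y 0)) := by
        refine (hfr y).congr' ?_
        filter_upwards [eventually_right_notMem S y] with z hz
        rw [if_neg hz]
      have h2 : Tendsto (fun z => ∑ x ∈ S, if x < z then J x else 0) (𝓝[>] y)
          (𝓝 (∑ x ∈ S, if x ≤ y then J x else 0)) := by
        refine tendsto_finsetSum _ fun x _ => tendsto_const_nhds.congr' ?_
        by_cases hxy : x ≤ y
        · filter_upwards [self_mem_nhdsWithin] with z hz
          rw [if_pos hxy, if_pos (lt_of_le_of_lt hxy hz)]
        · filter_upwards [mem_nhdsWithin_of_mem_nhds (gt_mem_nhds (not_le.mp hxy))] with z hz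
          rw [if_neg hxy, if_neg (not_lt.mpr (le_of_lt hz))]
      have h3 : (∑ x ∈ S, if x ≤ y then J x else 0) =
          (∑ x ∈ S, if x < y then J x else 0) + if y ∈ S then J y else 0 := by
        rw [← Finset.sum_ite_eq' S y J, ← Finset.sum_add_distrib]
        refine Finset.sum_congr rfl fun x _ => ?_
        rcases lt_trichotomy x y with hxy | hxy | hxy
        · simp [hxy, hxy.le, hxy.ne]
        · simp [hxy]
        · simp [hxy.not_ge, hxy.not_gt, hxy.ne']
      have h4 := h1.sub h2
      rw [h3] at h4
      have h5 : h y = rightJet f y 0 -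
          ((∑ x ∈ S, if x < y then J x else 0) + if y ∈ S then J y else 0) := by
        simp only [hh]
        by_cases hy : y ∈ S
        · rw [if_pos hy, if_pos hy]; simp only [J]; ring
        · rw [if_neg hy, if_neg hy, rightJet_eq_of_contDiffAt (hf.contDiffAt hy), jet_zero]; ring
      change Tendsto h (𝓝[>] y) (𝓝 (h y))
      rw [h5]
      exact h4
  have hderiv : ∀ x ∉ S, HasDerivAt h (deriv f x) x := by
    intro x hx
    have h1 : HasDerivAt f (deriv f x) x :=
      ((hf.contDiffAt hx).differentiableAt (by simp)).hasDerivAt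
    have h2 : h =ᶠ[𝓝 x] fun y => f y - ∑ z ∈ S, if z < x then J z else 0 := by
      have h3 : ∀ᶠ y in 𝓝 x, ∀ z ∈ S, (z < y ↔ z < x) := by
        refine (Filter.eventually_all_finset S).mpr fun z hz => ?_
        rcases lt_or_gt_of_ne (fun h => hx (h ▸ hz) : z ≠ x) with hzx | hzx
        · filter_upwards [lt_mem_nhds hzx] with y hy
          exact ⟨fun _ => hzx, fun _ => hy⟩
        · filter_upwards [gt_mem_nhds hzx] with y hy
          exact ⟨fun h => absurd h hy.le.not_gt, fun h => absurd h hzx.le.not_gt⟩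
      filter_upwards [(isOpen_compl_finset S).mem_nhds (by simpa using hx), h3] with y hy h3y
      simp only [hh, if_neg (show y ∉ S by simpa using hy)]
      rw [Finset.sum_congr rfl fun z hz => by rw [if_congr (h3y z hz) rfl rfl]]
    exact (h1.sub_const _).congr_of_eventuallyEq h2
  have hint : LocallyIntegrable (deriv f) volume := by
    have := (hf.pwSmooth_iteratedDeriv 1).locallyIntegrable
    rwa [iteratedDeriv_one] at this
  have hfz : ∀ y, y ∉ Ioo (-R) R → (if y ∈ S then leftJet f y 0 else f y) = 0 := by
    intro y hy
    rw [if_neg fun hS : y ∈ S => hy (hR (Or.inr hS))]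
    exact image_eq_zero_of_notMem_tsupport fun hS => hy (hR (Or.inl hS))
  have h1 := MeasureTheory.integral_eq_of_hasDerivAt_off_countable (a := -R) (b := R) h (deriv f)
    S.finite_toSet.countable hcont.continuousOn (fun x hx => hderiv x (by simpa using hx.2))
    (hint.integrableOn_isCompact isCompact_uIcc).intervalIntegrable
  have h2 : ∫ x in (-R)..R, deriv f x = ∫ x, deriv f x := by
    refine intervalIntegral.integral_eq_integral_of_support_subset ?_
    intro x hx
    have := support_deriv_subset hx
    exact Ioo_subset_Ioc_self (hR (Or.inl this))
  rw [h2] at h1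
  rw [h1]
  simp only [hh]
  rw [hfz R (by simp), hfz (-R) (by simp), Finset.sum_congr rfl fun x hx => if_pos
    ((hR (Or.inr hx)).2), Finset.sum_congr (g := fun _ => 0) rfl fun x hx => if_neg
    (not_lt.mpr (hR (Or.inr hx)).1.le)]
  simp

/-- Integration by parts for a piecewise smooth function and a test function. -/
theorem PwSmooth.integral_deriv_mul (hf : PwSmooth S f) (t : Test) :
    ∫ x, t.deriv x * f x =
      -(∫ x, t x * deriv f x) - ∑ x ∈ S, (rightJet f x 0 - leftJet f x 0) * t x := by
  have ht : PwSmooth S t := PwSmooth.of_contDiff t.contDiff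
  have h1 := (ht.mul hf).integral_deriv t.hasCompactSupport.mul_right
  have hint : LocallyIntegrable (deriv f) volume := by
    have := (hf.pwSmooth_iteratedDeriv 1).locallyIntegrable
    rwa [iteratedDeriv_one] at this
  have h2 : ∫ x, deriv (fun y => t y * f y) x =
      ∫ x, (t.deriv x * f x + t x * deriv f x) := by
    refine integral_congr_ae ?_
    filter_upwards [S.finite_toSet.countable.ae_notMem volume] with x hx
    exact ((t.hasDerivAt x).mul
      ((hf.contDiffAt hx).differentiableAt (by simp)).hasDerivAt).deriv
  rw [h2, integral_add (t.deriv.integrable_mul hf.locallyIntegrable) (t.integrable_mul hint)] at h1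
  have h3 : ∑ x ∈ S, (rightJet (fun y => t y * f y) x 0 - leftJet (fun y => t y * f y) x 0) =
      ∑ x ∈ S, (rightJet f x 0 - leftJet f x 0) * t x := by
    refine Finset.sum_congr rfl fun x _ => ?_
    rw [ht.rightJet_mul hf, ht.leftJet_mul hf, leftJet_eq_of_contDiffAt t.contDiff.contDiffAt,
      rightJet_eq_of_contDiffAt t.contDiff.contDiffAt]
    simp [jetMul, jet_zero]
    ring
  rw [h3] at h1
  linear_combination h1

/-! ### Normal form of the elements of `𝒜` -/

/-- Normal form of an element of `𝒜`: `F` is the sum of the regular distribution of the piecewise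
smooth function `f` and, at every point `x` of the finite set `S`, of the combination of
derivatives of the Dirac delta encoded by the polynomial `c x`. -/
structure Rep (S : Finset ℝ) (f : ℝ → ℂ) (c : ℝ → Polynomial ℂ) (F : Distr) : Prop where
  pwSmooth : PwSmooth S f
  eq_zero : ∀ x ∉ S, c x = 0
  apply : ∀ t : Test, F t = (∫ x, t x * f x) + ∑ x ∈ S, pairing (c x) (jet t x)

theorem Rep.mono {c : ℝ → Polynomial ℂ} {F : Distr} (h : Rep S f c F) (hST : S ⊆ T) :
    Rep T f c F where
  pwSmooth := h.pwSmooth.mono hST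
  eq_zero x hx := h.eq_zero x fun hS => hx (hST hS)
  apply t := by
    rw [h.apply, Finset.sum_subset hST]
    intro x _ hx
    rw [h.eq_zero x hx, pairing_zero]

theorem PwSmooth.rep (hf : PwSmooth S f) : Rep S f 0 (reg f) where
  pwSmooth := hf
  eq_zero _ _ := rfl
  apply t := by simp [reg_apply hf.locallyIntegrable]

/-- The polynomials of the point parts of the `i`-th derivative of a distribution with function
part `f` and point parts `c`. -/
noncomputable def derivCoeff (S : Finset ℝ) (f : ℝ → ℂ) (c : ℝ → Polynomial ℂ) (i : ℕ) (x : ℝ) :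
    Polynomial ℂ :=
  match i with
  | 0 => c x
  | i + 1 => -(Polynomial.X * derivCoeff S f c i x) +
      Polynomial.C (rightJet f x i - leftJet f x i)

theorem isDerivSeq_derivCoeff (S : Finset ℝ) (f : ℝ → ℂ) (c : ℝ → Polynomial ℂ) (x : ℝ) :
    IsDerivSeq (fun i => derivCoeff S f c i x) fun i => rightJet f x i - leftJet f x i :=
  fun _ => rfl

theorem Rep.dDeriv_iterate {c : ℝ → Polynomial ℂ} {F : Distr} (h : Rep S f c F) (i : ℕ) :
    Rep S (iteratedDeriv i f) (derivCoeff S f c i) (dDeriv^[i] F) := by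
  induction i with
  | zero => exact ⟨by simpa using h.pwSmooth, h.eq_zero, by simpa [derivCoeff] using h.apply⟩
  | succ i ih =>
    refine ⟨h.pwSmooth.pwSmooth_iteratedDeriv _, fun x hx => ?_, fun t => ?_⟩
    · have hJ : rightJet f x i - leftJet f x i = 0 := by
        rw [rightJet_eq_of_contDiffAt (h.pwSmooth.contDiffAt hx),
          leftJet_eq_of_contDiffAt (h.pwSmooth.contDiffAt hx), sub_self]
      simp [derivCoeff, ih.eq_zero x hx, hJ]
    · rw [Function.iterate_succ_apply', dDeriv_apply, ih.apply, ih.pwSmooth.integral_deriv_mul,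
        ← iteratedDeriv_succ, neg_add, neg_sub, ← Finset.sum_neg_distrib, sub_neg_eq_add,
        add_comm (Finset.sum _ _), add_assoc, ← Finset.sum_add_distrib]
      congr 1
      refine Finset.sum_congr rfl fun x _ => ?_
      rw [jet_deriv, ← pairing_X_mul, derivCoeff, pairing_add, pairing_C, pairing_neg, jet_zero,
        rightJet_iteratedDeriv, leftJet_iteratedDeriv, zero_add]
      ring

theorem exists_rep {F : Distr} (hF : F ∈ 𝒜) : ∃ S f c, Rep S f c F := by
  obtain ⟨k, g, hg, rfl⟩ := hF
  obtain ⟨S, hS⟩ := hg.exists_pwSmooth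
  exact ⟨_, _, _, hS.rep.dDeriv_iterate k⟩

end

section

variable {S T : Finset ℝ} {f g : ℝ → ℂ}

/-! ### Test functions with prescribed jets -/

/-- The divided power `y ↦ (y - x) ^ k / k!`. -/
noncomputable def divPow (x : ℝ) (k : ℕ) (y : ℝ) : ℂ := ((y - x : ℝ) : ℂ) ^ k / (k.factorial : ℂ)

theorem contDiff_divPow (x : ℝ) (k : ℕ) : ContDiff ℝ ∞ (divPow x k) :=
  ((Complex.ofRealCLM.contDiff.comp (contDiff_id.sub contDiff_const)).pow k).div_const _

theorem deriv_divPow_zero (x : ℝ) : deriv (divPow x 0) = fun _ => 0 := by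
  have h : divPow x 0 = fun _ => 1 := by funext y; simp [divPow]
  rw [h]; simp

theorem deriv_divPow_succ (x : ℝ) (k : ℕ) : deriv (divPow x (k + 1)) = divPow x k := by
  funext y
  have h1 : HasDerivAt (fun y : ℝ => ((y - x : ℝ) : ℂ)) 1 y := by
    simpa using ((hasDerivAt_id y).sub_const x).ofReal_comp
  have h2 := ((h1.pow (k + 1)).div_const ((k + 1).factorial : ℂ)).deriv
  have h3 : deriv (divPow x (k + 1)) y = _ := h2
  rw [h3, divPow, Nat.factorial_succ]
  have h4 : ((k : ℂ) + 1) ≠ 0 := by exact_mod_cast Nat.succ_ne_zero k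
  have h5 : (k.factorial : ℂ) ≠ 0 := by exact_mod_cast Nat.factorial_ne_zero k
  push_cast
  field_simp

theorem iteratedDeriv_divPow_add (x : ℝ) (k j : ℕ) :
    iteratedDeriv j (divPow x (k + j)) = divPow x k := by
  induction j with
  | zero => simp
  | succ j ih => rw [iteratedDeriv_succ', ← add_assoc, deriv_divPow_succ, ih]

theorem iteratedDeriv_divPow_of_lt (x : ℝ) {k j : ℕ} (h : k < j) :
    iteratedDeriv j (divPow x k) = fun _ => 0 := by
  obtain ⟨i, rfl⟩ := Nat.exists_eq_add_of_lt h
  have h1 : iteratedDeriv k (divPow x k) = divPow x 0 := by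
    simpa using iteratedDeriv_divPow_add x 0 k
  have h2 : k + i + 1 = i + (k + 1) := by ring
  rw [h2, ← iteratedDeriv_add_iteratedDeriv, iteratedDeriv_succ, h1, deriv_divPow_zero]
  funext y
  simp

theorem jet_divPow (x : ℝ) (k : ℕ) : jet (divPow x k) x = fun j => if j = k then 1 else 0 := by
  funext j
  simp only [jet]
  rcases lt_trichotomy j k with h | rfl | h
  · obtain ⟨i, rfl⟩ := Nat.exists_eq_add_of_lt h
    have h2 : j + i + 1 = (i + 1) + j := by ring
    rw [h2, iteratedDeriv_divPow_add, if_neg (by lia)]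
    simp [divPow]
  · have h1 : iteratedDeriv j (divPow x j) = divPow x 0 := by
      simpa using iteratedDeriv_divPow_add x 0 j
    rw [h1]; simp [divPow]
  · rw [iteratedDeriv_divPow_of_lt x h, if_neg h.ne']

/-- A test function from a smooth function with compact support. -/
def Test.mk' (f : ℝ → ℂ) (hf : ContDiff ℝ ∞ f) (hc : HasCompactSupport f) : Test :=
  ⟨f, hf, hc, by simp⟩

@[simp]
theorem Test.coe_mk' (f : ℝ → ℂ) (hf : ContDiff ℝ ∞ f) (hc : HasCompactSupport f) :
    ⇑(Test.mk' f hf hc) = f := rfl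

theorem contDiff_ofReal_comp {φ : ℝ → ℝ} (hφ : ContDiff ℝ ∞ φ) :
    ContDiff ℝ ∞ fun y => ((φ y : ℝ) : ℂ) :=
  Complex.ofRealCLM.contDiff.comp hφ

theorem exists_test_jet_zero (k : ℕ) : ∃ s : Test,
    tsupport s ⊆ Metric.closedBall 0 1 ∧ jet s 0 = fun j => if j = k then 1 else 0 := by
  let φ : ContDiffBump (0 : ℝ) := ⟨1 / 2, 1, by norm_num, by norm_num⟩
  have hφ : ContDiff ℝ ∞ fun y : ℝ => ((φ y : ℝ) : ℂ) := contDiff_ofReal_comp φ.contDiff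
  have hts : tsupport (fun y => divPow 0 k y * ((φ y : ℝ) : ℂ)) ⊆ Metric.closedBall 0 1 := by
    refine closure_minimal ?_ Metric.isClosed_closedBall
    intro y hy
    by_contra h
    refine hy ?_
    have : φ y = 0 := φ.zero_of_le_dist (le_of_lt (by simpa using h))
    simp [this]
  refine ⟨Test.mk' (fun y => divPow 0 k y * ((φ y : ℝ) : ℂ)) ((contDiff_divPow 0 k).mul hφ)
    (HasCompactSupport.of_support_subset_isCompact (isCompact_closedBall 0 1)
      ((subset_tsupport _).trans hts)), hts, ?_⟩
  rw [Test.coe_mk', ← jet_divPow, jet_congr]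
  filter_upwards [φ.eventuallyEq_one] with y hy
  simp [hy]

/-- The rescaled function `y ↦ ε ^ k s((y - x) / ε)` is a test function; the normalization keeps
the `k`-th derivative at the center fixed. -/
theorem Test.exists_rescale (s : Test) (hs : tsupport s ⊆ Metric.closedBall 0 1) (k : ℕ) (x : ℝ)
    {ε : ℝ} (hε : 0 < ε) : ∃ t : Test, tsupport t ⊆ Metric.closedBall x ε ∧
      ∀ j y, iteratedDeriv j t y = (ε ^ k * (ε⁻¹) ^ j : ℝ) • iteratedDeriv j s (ε⁻¹ * (y - x)) := by
  have h0 : ∀ y, ε⁻¹ * (y - x) ∈ Metric.closedBall (0 : ℝ) 1 → y ∈ Metric.closedBall x ε := by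
    intro y hy
    rw [mem_closedBall_zero_iff, norm_mul, norm_inv, Real.norm_of_nonneg hε.le,
      inv_mul_le_iff₀ hε, mul_one] at hy
    rwa [Metric.mem_closedBall, dist_eq_norm]
  have hts : tsupport (fun y => (ε ^ k : ℝ) • s (ε⁻¹ * (y - x))) ⊆ Metric.closedBall x ε := by
    refine closure_minimal (fun y hy => h0 y (hs (subset_tsupport _ fun h => hy ?_)))
      Metric.isClosed_closedBall
    simp [h]
  have hs1 : ContDiff ℝ ∞ fun y : ℝ => s (ε⁻¹ * (y - x)) :=
    s.contDiff.comp (contDiff_const.mul (contDiff_id.sub contDiff_const))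
  refine ⟨Test.mk' _ (hs1.const_smul (ε ^ k : ℝ)) (HasCompactSupport.of_support_subset_isCompact
    (isCompact_closedBall x ε) ((subset_tsupport _).trans hts)), hts, fun j y => ?_⟩
  rw [Test.coe_mk']
  have h1 := iteratedDeriv_comp_sub_const (n := j) (f := fun z : ℝ => s (ε⁻¹ * z)) (s := x)
  have h2 := iteratedDeriv_comp_const_smul (n := j)
    (s.contDiff.of_le (by exact_mod_cast le_top)) ε⁻¹
  have h3 : iteratedDeriv j ((ε ^ k : ℝ) • fun y => s (ε⁻¹ * (y - x))) y =
      (ε ^ k : ℝ) • iteratedDeriv j (fun y => s (ε⁻¹ * (y - x))) y :=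
    iteratedDeriv_const_smul (hs1.contDiffAt.of_le (by exact_mod_cast le_top)) _
  have h4 := congrFun h1 y
  simp only [h2] at h4
  refine h3.trans ?_
  rw [h4, mul_smul]

theorem exists_test_jet {U : Set ℝ} (hU : IsOpen U) {x : ℝ} (hx : x ∈ U) (k : ℕ) : ∃ t : Test,
    tsupport t ⊆ U ∧ jet t x = fun j => if j = k then 1 else 0 := by
  obtain ⟨s, hs, hj⟩ := exists_test_jet_zero k
  obtain ⟨ε, hε, hεU⟩ := Metric.nhds_basis_closedBall.mem_iff.mp (hU.mem_nhds hx)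
  obtain ⟨t, ht, htj⟩ := s.exists_rescale hs k x hε
  refine ⟨t, ht.trans hεU, funext fun j => ?_⟩
  have h := congrFun hj j
  simp only [jet] at h ⊢
  rw [htj, sub_self, mul_zero, h]
  split_ifs with hjk
  · subst hjk
    rw [← mul_pow, mul_inv_cancel₀ hε.ne']
    simp
  · simp

/-! ### Local uniqueness -/

/-- A smooth function together with point functionals vanishes on an open set as soon as it
vanishes on the test functions supported there. -/
theorem local_vanishing {U : Set ℝ} (hU : IsOpen U) {h : ℝ → ℂ}
    (hc : ContinuousOn h (U \ S)) {e : ℝ → Polynomial ℂ}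
    (H : ∀ t : Test, tsupport t ⊆ U → (∫ x, t x * h x) + ∑ x ∈ S, pairing (e x) (jet t x) = 0) :
    (∀ x ∈ U, x ∉ S → h x = 0) ∧ ∀ x ∈ S, x ∈ U → e x = 0 := by
  have hUS : IsOpen (U \ (S : Set ℝ)) := hU.sdiff S.finite_toSet.isClosed
  have h1 : ∀ᵐ x, x ∈ U \ (S : Set ℝ) → h x = 0 := by
    refine hUS.ae_eq_zero_of_integral_contDiff_smul_eq_zero
      (hc.locallyIntegrableOn hUS.measurableSet) fun φ hφ hφc hφU => ?_
    have hsupp : tsupport (fun y => ((φ y : ℝ) : ℂ)) ⊆ tsupport φ := by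
      refine closure_mono fun y hy => ?_
      simpa using hy
    have h2 := H (Test.mk' (fun y => ((φ y : ℝ) : ℂ)) (contDiff_ofReal_comp hφ)
      (hφc.comp_left (g := fun r : ℝ => (r : ℂ)) (by simp)))
      (hsupp.trans (hφU.trans sdiff_subset))
    rw [Finset.sum_eq_zero, add_zero] at h2
    · simpa using h2
    · intro x hx
      rw [Test.coe_mk', jet_eq_zero fun hx' => (hφU (hsupp hx')).2 hx]
      exact pairing_zero_right _
  have h3 : ∀ x ∈ U, x ∉ S → h x = 0 := by
    intro x hx hxS
    have h4 : EqOn h (fun _ => 0) (U \ (S : Set ℝ)) := by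
      refine Measure.eqOn_open_of_ae_eq (μ := volume) ?_ hUS hc continuousOn_const
      exact (ae_restrict_iff' hUS.measurableSet).mpr h1
    exact h4 ⟨hx, by simpa using hxS⟩
  refine ⟨h3, fun x hxS hxU => Polynomial.ext fun k => ?_⟩
  -- a test function whose only nonzero derivative at `x` is the `k`-th one, supported away from
  -- the other points of `S`, picks out the `k`-th coefficient
  have hV : IsOpen (U ∩ ((S.erase x : Finset ℝ) : Set ℝ)ᶜ) :=
    hU.inter (isOpen_compl_finset _)
  obtain ⟨t, htV, htj⟩ := exists_test_jet hV (x := x) ⟨hxU, by simp⟩ k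
  have h4 := H t (htV.trans inter_subset_left)
  have h5 : ∫ y, t y * h y = 0 := by
    refine integral_eq_zero_of_ae ?_
    filter_upwards [S.finite_toSet.countable.ae_notMem volume] with y hy
    by_cases hyU : y ∈ U
    · simp [h3 y hyU hy]
    · rw [image_eq_zero_of_notMem_tsupport fun hy' => hyU (htV hy').1]; simp
  rw [h5, zero_add, Finset.sum_eq_single_of_mem x hxS, htj, pairing_single] at h4
  · simpa using h4
  · intro y hy hyx
    rw [jet_eq_zero fun hy' => (htV hy').2 (by simp [hy, hyx])]
    exact pairing_zero_right _

theorem coe_mulTest {U : Set ℝ} (hU : IsOpen U) (hg : ContDiffOn ℝ ∞ g U) (t : Test)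
    (ht : tsupport t ⊆ U) : ⇑(mulTest hU hg t ht) = fun x => g x * t x := rfl

theorem tsupport_mulTest_subset {U : Set ℝ} (hU : IsOpen U) (hg : ContDiffOn ℝ ∞ g U) (t : Test)
    (ht : tsupport t ⊆ U) : tsupport (mulTest hU hg t ht) ⊆ tsupport t :=
  tsupport_mul_subset_right

theorem Test.integrable (t : Test) : Integrable t volume :=
  t.continuous.integrable_of_hasCompactSupport t.hasCompactSupport

theorem integrable_mul_of_contDiffOn {U : Set ℝ} (hU : IsOpen U) (hg : ContDiffOn ℝ ∞ g U)
    (t : Test) (ht : tsupport t ⊆ U) : Integrable (fun x => t x * g x) volume := by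
  have h := (mulTest hU hg t ht).integrable
  rw [coe_mulTest] at h
  simpa only [mul_comm] using h

/-- Where a distribution in normal form is a smooth function, its function part is this function
and its point parts vanish. -/
theorem Rep.eq_of_eqFunOn {c : ℝ → Polynomial ℂ} {F : Distr} (h : Rep S f c F) {U : Set ℝ}
    (hU : IsOpen U) (hg : ContDiffOn ℝ ∞ g U) (hF : EqFunOn F U g) :
    (∀ x ∈ U, x ∉ S → f x = g x) ∧ ∀ x ∈ U, c x = 0 := by
  have h1 := local_vanishing (S := S) hU (h := fun x => f x - g x) (e := c)
    ((h.pwSmooth.smooth.continuousOn.mono fun x hx => hx.2).sub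
      (hg.continuousOn.mono sdiff_subset)) fun t ht => by
    have h2 := h.apply t
    rw [hF t ht] at h2
    simp only [mul_sub]
    rw [integral_sub (t.integrable_mul h.pwSmooth.locallyIntegrable)
      (integrable_mul_of_contDiffOn hU hg t ht), h2]
    ring
  refine ⟨fun x hx hxS => sub_eq_zero.mp (h1.1 x hx hxS), fun x hx => ?_⟩
  by_cases hxS : x ∈ S
  · exact h1.2 x hxS hx
  · exact h.eq_zero x hxS

theorem eqOn_of_eqFunOn {F : Distr} {U V : Set ℝ} (hU : IsOpen U) (hV : IsOpen V)
    (hf : ContDiffOn ℝ ∞ f U) (hg : ContDiffOn ℝ ∞ g V) (h1 : EqFunOn F U f)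
    (h2 : EqFunOn F V g) : EqOn f g (U ∩ V) := by
  have h := local_vanishing (S := ∅) (hU.inter hV) (h := fun x => f x - g x) (e := 0)
    (((hf.continuousOn.mono inter_subset_left).sub
      (hg.continuousOn.mono inter_subset_right)).mono sdiff_subset) fun t ht => by
    simp only [mul_sub]
    rw [integral_sub (integrable_mul_of_contDiffOn hU hf t (ht.trans inter_subset_left))
      (integrable_mul_of_contDiffOn hV hg t (ht.trans inter_subset_right)),
      ← h1 t (ht.trans inter_subset_left), ← h2 t (ht.trans inter_subset_right)]
    simp
  exact fun x hx => sub_eq_zero.mp (h.1 x hx (by simp))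

/-- Two distributions that agree on each member of a finite open cover are equal. -/
theorem Distr.eq_of_cover {ι : Type} [Fintype ι] {U : ι → Set ℝ} (hU : ∀ i, IsOpen (U i))
    (hcover : ⋃ i, U i = univ) {P Q : Distr}
    (h : ∀ i, ∀ t : Test, tsupport t ⊆ U i → P t = Q t) : P = Q := by
  obtain ⟨ρ, hρ⟩ := SmoothPartitionOfUnity.exists_isSubordinate (modelWithCornersSelf ℝ ℝ)
    isClosed_univ U hU hcover.ge
  ext t
  have hsm : ∀ i, ContDiff ℝ ∞ fun y => ((ρ i y : ℝ) : ℂ) * t y := fun i =>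
    (contDiff_ofReal_comp (ρ i).contMDiff.contDiff).mul t.contDiff
  let τ : ι → Test := fun i => Test.mk' _ (hsm i) t.hasCompactSupport.mul_left
  have hτ : t = ∑ i, τ i := by
    ext y
    have h1 := ρ.sum_eq_one (mem_univ y)
    rw [finsum_eq_sum_of_fintype] at h1
    have h2 : (∑ i, τ i) y = ∑ i, τ i y := by
      exact map_sum ({ toFun := fun s : Test => s y, map_zero' := rfl, map_add' := fun _ _ => rfl } :
        Test →+ ℂ) _ _
    rw [h2]
    simp only [τ, Test.coe_mk']
    rw [← Finset.sum_mul, ← Complex.ofReal_sum, h1]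
    simp
  rw [hτ, map_sum, map_sum]
  refine Finset.sum_congr rfl fun i _ => h i _ ?_
  refine (tsupport_mul_subset_left (f := fun y => ((ρ i y : ℝ) : ℂ)) (g := t)).trans ?_
  refine (closure_mono fun y hy => ?_).trans (hρ i)
  simpa using hy

end

section

variable {S T : Finset ℝ} {f g : ℝ → ℂ}

/-! ### Distributions supported at a point -/

theorem derivCoeff_zero_coeff (x : ℝ) (i m : ℕ) :
    (derivCoeff S f 0 i x).coeff m =
      if m < i then (-1) ^ m * (rightJet f x (i - 1 - m) - leftJet f x (i - 1 - m)) else 0 := by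
  induction i generalizing m with
  | zero => simp [derivCoeff]
  | succ i ih =>
    rw [derivCoeff, Polynomial.coeff_add, Polynomial.coeff_neg]
    rcases m with _ | m
    · simp
    · rw [Polynomial.coeff_X_mul, ih, Polynomial.coeff_C_of_ne_zero (by lia)]
      have h1 : i + 1 - 1 - (m + 1) = i - 1 - m := by lia
      rw [h1]
      by_cases h : m < i
      · rw [if_pos h, if_pos (by lia)]; ring
      · rw [if_neg h, if_neg (by lia)]; simp

/-- Every combination of derivatives of the Dirac delta at `x` of order less than `K` is the `K`-th
derivative of a function which vanishes on the left of `x` and is a polynomial on the right of `x`: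
the coefficients of this polynomial are the jumps of its derivatives at `x`. -/
theorem exists_dDeriv_iterate_eq_pairing (x : ℝ) {c : Polynomial ℂ} {K : ℕ}
    (hc : ∀ j, K ≤ j → c.coeff j = 0) : ∃ h : ℝ → ℂ, LocallyIntegrable h volume ∧
      ∀ t : Test, dDeriv^[K] (reg h) t = pairing c (jet t x) := by
  set J : ℕ → ℂ := fun i => (-1) ^ (K - 1 - i) * c.coeff (K - 1 - i) with hJ
  set p : ℝ → ℂ := fun y => ∑ i ∈ Finset.range K, J i * divPow x i y with hp
  have hterm : ∀ i ∈ Finset.range K, ContDiff ℝ ∞ fun y => J i * divPow x i y := fun i _ =>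
    contDiff_const.mul (contDiff_divPow x i)
  have hpd : ContDiff ℝ ∞ p := ContDiff.sum hterm
  have hder : ∀ j y, iteratedDeriv j p y =
      ∑ i ∈ Finset.range K, J i * iteratedDeriv j (divPow x i) y := by
    intro j y
    rw [hp, iteratedDeriv_fun_sum fun i hi => (hterm i hi).contDiffAt.of_le
      (by exact_mod_cast le_top)]
    refine Finset.sum_congr rfl fun i _ => ?_
    exact iteratedDeriv_const_mul_field (J i) (divPow x i)
  set h : ℝ → ℂ := (Ioi x).indicator p with hh
  have hr : ∀ y, x < y → h =ᶠ[𝓝 y] p := fun y hy => by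
    filter_upwards [lt_mem_nhds hy] with z hz
    exact indicator_of_mem hz p
  have hl : ∀ y, y < x → h =ᶠ[𝓝 y] fun _ => 0 := fun y hy => by
    filter_upwards [gt_mem_nhds hy] with z hz
    exact indicator_of_notMem (not_lt.mpr (le_of_lt hz)) p
  have hsmooth : ∀ y ≠ x, ContDiffAt ℝ ∞ h y := fun y hy => by
    rcases lt_or_gt_of_ne hy with hy | hy
    · exact contDiffAt_const.congr_of_eventuallyEq (hl y hy)
    · exact hpd.contDiffAt.congr_of_eventuallyEq (hr y hy)
  have hlx : h =ᶠ[𝓝[<] x] fun _ => 0 := by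
    filter_upwards [self_mem_nhdsWithin] with z hz
    exact indicator_of_notMem (not_lt.mpr (le_of_lt hz)) p
  have hrx : h =ᶠ[𝓝[>] x] p := by
    filter_upwards [self_mem_nhdsWithin] with z hz
    exact indicator_of_mem hz p
  have hps : PwSmooth {x} h := by
    refine ⟨fun y hy => (hsmooth y (by simpa using hy)).contDiffWithinAt, fun y k => ?_,
      fun y k => ?_⟩
    · rcases eq_or_ne y x with rfl | hy
      · exact ⟨_, (((tendsto_iteratedDeriv contDiffAt_const k).mono_left
          nhdsWithin_le_nhds).congr' (eventuallyEq_iteratedDeriv_left hlx k).symm)⟩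
      · exact ⟨_, (tendsto_iteratedDeriv (hsmooth y hy) k).mono_left nhdsWithin_le_nhds⟩
    · rcases eq_or_ne y x with rfl | hy
      · exact ⟨_, (((tendsto_iteratedDeriv hpd.contDiffAt k).mono_left
          nhdsWithin_le_nhds).congr' (eventuallyEq_iteratedDeriv_right hrx k).symm)⟩
      · exact ⟨_, (tendsto_iteratedDeriv (hsmooth y hy) k).mono_left nhdsWithin_le_nhds⟩
  refine ⟨h, hps.locallyIntegrable, fun t => ?_⟩
  rw [(hps.rep.dDeriv_iterate K).apply, integral_eq_zero_of_ae, zero_add, Finset.sum_singleton]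
  · congr 1
    refine Polynomial.ext fun m => ?_
    rw [derivCoeff_zero_coeff, rightJet_congr hrx, leftJet_congr hlx,
      rightJet_eq_of_contDiffAt hpd.contDiffAt, leftJet_eq_of_contDiffAt contDiffAt_const]
    split_ifs with hm
    · have h1 : jet (fun _ : ℝ => (0 : ℂ)) x (K - 1 - m) = 0 := by simp [jet]
      have h2 : jet p x (K - 1 - m) = J (K - 1 - m) := by
        have h3 : ∀ i, iteratedDeriv (K - 1 - m) (divPow x i) x = if K - 1 - m = i then 1 else 0 :=
          fun i => congrFun (jet_divPow x i) (K - 1 - m)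
        rw [jet, hder]
        simp only [h3, mul_ite, mul_one, mul_zero]
        rw [Finset.sum_ite_eq, if_pos (Finset.mem_range.mpr (by lia))]
      have h4 : K - 1 - (K - 1 - m) = m := by lia
      rw [h1, h2, hJ]
      simp only [h4, sub_zero, ← mul_assoc, ← mul_pow]
      simp
    · exact (hc m (not_lt.mp hm)).symm
  · filter_upwards [Measure.ae_ne volume x] with y hy
    have h1 : iteratedDeriv K h y = 0 := by
      rcases lt_or_gt_of_ne hy with hy | hy
      · rw [(hl y hy).iteratedDeriv_eq]; simp
      · rw [(hr y hy).iteratedDeriv_eq, hder]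
        refine Finset.sum_eq_zero fun i hi => ?_
        rw [iteratedDeriv_divPow_of_lt x (Finset.mem_range.mp hi), mul_zero]
    simp [h1]

theorem exists_pointDistr (x : ℝ) (c : Polynomial ℂ) :
    ∃ F : Distr, ∀ t : Test, F t = pairing c (jet t x) := by
  obtain ⟨h, -, hF⟩ := exists_dDeriv_iterate_eq_pairing x (c := c) (K := c.natDegree + 1)
    fun j hj => Polynomial.coeff_eq_zero_of_natDegree_lt hj
  exact ⟨_, hF⟩

/-- The combination of derivatives of the Dirac delta at `x` encoded by the polynomial `c`. -/
noncomputable def pointDistr (x : ℝ) (c : Polynomial ℂ) : Distr := (exists_pointDistr x c).choose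

theorem pointDistr_apply (x : ℝ) (c : Polynomial ℂ) (t : Test) :
    pointDistr x c t = pairing c (jet t x) :=
  (exists_pointDistr x c).choose_spec t

theorem reg_add (hf : LocallyIntegrable f volume) (hg : LocallyIntegrable g volume) :
    reg (fun x => f x + g x) = reg f + reg g := by
  ext t
  have h1 : LocallyIntegrable (fun x => f x + g x) volume := hf.add hg
  rw [add_apply, reg_apply h1, reg_apply hf, reg_apply hg]
  simp only [mul_add]
  exact integral_add (t.integrable_mul hf) (t.integrable_mul hg)

theorem dDeriv_add (F G : Distr) : dDeriv (F + G) = dDeriv F + dDeriv G := by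
  ext t
  simp only [dDeriv_apply, add_apply, neg_add]

theorem dDeriv_iterate_add (K : ℕ) (F G : Distr) :
    dDeriv^[K] (F + G) = dDeriv^[K] F + dDeriv^[K] G := by
  induction K with
  | zero => rfl
  | succ K ih => simp only [Function.iterate_succ_apply', ih, dDeriv_add]

/-- A combination of derivatives of Dirac deltas of order less than `K` has order at most `K`. -/
theorem exists_sum_pointDistr_eq (c : ℝ → Polynomial ℂ) {K : ℕ}
    (hc : ∀ x, ∀ j, K ≤ j → (c x).coeff j = 0) : ∃ h : ℝ → ℂ, LocallyIntegrable h volume ∧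
      ∑ x ∈ S, pointDistr x (c x) = dDeriv^[K] (reg h) := by
  classical
  induction S using Finset.induction_on with
  | empty =>
    obtain ⟨h, hh, h1⟩ := exists_dDeriv_iterate_eq_pairing 0 (c := 0) (K := K) (by simp)
    refine ⟨h, hh, ?_⟩
    ext t
    rw [h1]
    simp
  | insert x S hx ih =>
    obtain ⟨h, hh, h1⟩ := ih
    obtain ⟨h', hh', h2⟩ := exists_dDeriv_iterate_eq_pairing x (hc x)
    refine ⟨fun y => h' y + h y, hh'.add hh, ?_⟩
    rw [Finset.sum_insert hx, reg_add hh' hh, dDeriv_iterate_add, ← h1]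
    congr 1
    ext t
    rw [h2, pointDistr_apply]

theorem ord_sum_pointDistr_le (c : ℝ → Polynomial ℂ) {K : ℕ}
    (hc : ∀ x, ∀ j, K ≤ j → (c x).coeff j = 0) : ord (∑ x ∈ S, pointDistr x (c x)) ≤ K := by
  obtain ⟨h, hh, h1⟩ := exists_sum_pointDistr_eq (S := S) c hc
  exact sInf_le ⟨K, h, rfl, hh, h1⟩

/-! ### The order of the point parts -/

/-- The supports shrink to `x` while the functions stay bounded. -/
theorem tendsto_rescaled_integral (s : Test) (hs : tsupport s ⊆ Metric.closedBall 0 1) (x : ℝ)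
    (hg : LocallyIntegrable g volume) (m : ℕ) :
    Tendsto (fun ε : ℝ => ∫ y, ((ε ^ m : ℝ) • s (ε⁻¹ * (y - x))) * g y) (𝓝[>] 0) (𝓝 0) := by
  obtain ⟨C, hC⟩ : ∃ C, ∀ y, ‖s y‖ ≤ C := s.continuous.bounded_above_of_compact_support
    s.hasCompactSupport
  have hC0 : 0 ≤ C := (norm_nonneg _).trans (hC 0)
  have hsupp : ∀ ε : ℝ, 0 < ε → ∀ y, ε < |y - x| → s (ε⁻¹ * (y - x)) = 0 := by
    intro ε hε y hy
    refine image_eq_zero_of_notMem_tsupport fun h => ?_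
    have h1 := hs h
    rw [mem_closedBall_zero_iff, norm_mul, norm_inv, Real.norm_of_nonneg hε.le,
      inv_mul_le_iff₀ hε, mul_one, Real.norm_eq_abs] at h1
    exact absurd h1 (not_le.mpr hy)
  have hI : Integrable ((Metric.closedBall x 1).indicator g) volume :=
    (hg.integrableOn_isCompact (isCompact_closedBall x 1)).integrable_indicator
      measurableSet_closedBall
  rw [← integral_zero ℝ ℂ]
  refine tendsto_integral_filter_of_dominated_convergence
    (fun y => C * ‖(Metric.closedBall x 1).indicator g y‖) ?_ ?_ (hI.norm.const_mul C) ?_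
  · refine Eventually.of_forall fun ε => AEStronglyMeasurable.mul ?_ hg.aestronglyMeasurable
    have h1 : Continuous s := s.continuous
    have : Continuous fun y => (ε ^ m : ℝ) • s (ε⁻¹ * (y - x)) := by fun_prop
    exact this.aestronglyMeasurable
  · filter_upwards [self_mem_nhdsWithin, mem_nhdsWithin_of_mem_nhds (gt_mem_nhds one_pos)]
      with ε hε hε1
    refine Eventually.of_forall fun y => ?_
    have hε' : (0 : ℝ) < ε := hε
    by_cases hy : y ∈ Metric.closedBall x 1
    · rw [indicator_of_mem hy, norm_mul, norm_smul, norm_pow, Real.norm_of_nonneg hε'.le]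
      refine mul_le_mul_of_nonneg_right ?_ (norm_nonneg _)
      calc ε ^ m * ‖s (ε⁻¹ * (y - x))‖ ≤ 1 * C :=
            mul_le_mul (pow_le_one₀ hε'.le (le_of_lt hε1)) (hC _) (norm_nonneg _) zero_le_one
        _ = C := one_mul C
    · have h1 : ε < |y - x| := by
        rw [Metric.mem_closedBall, not_le, Real.dist_eq] at hy
        exact lt_trans hε1 hy
      rw [hsupp ε hε' y h1]
      simp only [smul_zero, zero_mul, norm_zero]
      positivity
  · filter_upwards [Measure.ae_ne volume x] with y hy
    refine tendsto_const_nhds.congr' ?_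
    filter_upwards [self_mem_nhdsWithin, mem_nhdsWithin_of_mem_nhds
      (gt_mem_nhds (abs_pos.mpr (sub_ne_zero.mpr hy)))] with ε hε hε1
    rw [hsupp ε hε y hε1]
    simp

theorem dDeriv_iterate_apply (K : ℕ) (F : Distr) (t : Test) :
    dDeriv^[K] F t = (-1) ^ K * F (Test.deriv^[K] t) := by
  induction K generalizing t with
  | zero => simp
  | succ K ih =>
    rw [Function.iterate_succ_apply', dDeriv_apply, ih, Function.iterate_succ_apply]
    ring

theorem Test.coe_deriv_iterate (K : ℕ) (t : Test) :
    ⇑(Test.deriv^[K] t) = iteratedDeriv K t := by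
  induction K with
  | zero => simp
  | succ K ih => rw [Function.iterate_succ_apply', Test.coe_deriv, ih, iteratedDeriv_succ]

theorem tsupport_deriv_subset (t : Test) : tsupport t.deriv ⊆ tsupport t := by
  rw [Test.coe_deriv]
  exact closure_minimal support_deriv_subset (isClosed_tsupport _)

theorem tsupport_deriv_iterate_subset (K : ℕ) (t : Test) :
    tsupport (Test.deriv^[K] t) ⊆ tsupport t := by
  induction K with
  | zero => exact subset_rfl
  | succ K ih =>
    rw [Function.iterate_succ_apply']
    exact (tsupport_deriv_subset _).trans ih

/-- The point parts of a distribution of order at most `M` involve only derivatives of the Dirac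
delta of order less than `M`. This is seen on test functions shrinking to a point, whose derivative
of a given order at this point is kept fixed. -/
theorem Rep.coeff_eq_zero {c : ℝ → Polynomial ℂ} {F : Distr} (h : Rep S f c F) {M : ℕ}
    (hg : LocallyIntegrable g volume) (hF : F = dDeriv^[M] (reg g)) (x : ℝ) {k : ℕ} (hk : M ≤ k) :
    (c x).coeff k = 0 := by
  classical
  by_cases hx : x ∉ S
  · simp [h.eq_zero x hx]
  rw [not_not] at hx
  obtain ⟨s, hs, hsj⟩ := exists_test_jet_zero k
  have h1 := tendsto_rescaled_integral s hs x h.pwSmooth.locallyIntegrable k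
  have h2 := (tendsto_rescaled_integral (Test.deriv^[M] s)
    ((tsupport_deriv_iterate_subset M s).trans hs) x hg (k - M)).const_mul ((-1) ^ M)
  have h3 := h2.sub h1
  rw [mul_zero, sub_zero] at h3
  refine tendsto_nhds_unique (tendsto_const_nhds.congr' ?_) h3
  have hball : ((S.erase x : Finset ℝ) : Set ℝ)ᶜ ∈ 𝓝 x :=
    (isOpen_compl_finset _).mem_nhds (by simp)
  obtain ⟨r, hr, hrS⟩ := Metric.nhds_basis_closedBall.mem_iff.mp hball
  filter_upwards [self_mem_nhdsWithin, mem_nhdsWithin_of_mem_nhds (gt_mem_nhds hr)] with ε hε hεr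
  have hε' : (0 : ℝ) < ε := hε
  obtain ⟨t, ht, htj⟩ := s.exists_rescale hs k x hε'
  have h4 := h.apply t
  rw [Finset.sum_eq_single_of_mem x hx] at h4
  · have h5 : jet t x = fun j => if j = k then 1 else 0 := by
      funext j
      have h := congrFun hsj j
      simp only [jet] at h ⊢
      rw [htj, sub_self, mul_zero, h]
      split_ifs with hjk
      · subst hjk
        rw [← mul_pow, mul_inv_cancel₀ hε'.ne']
        simp
      · simp
    rw [h5, pairing_single, hF, dDeriv_iterate_apply, reg_apply hg, Test.coe_deriv_iterate] at h4
    have h6 : ∀ y, t y = (ε ^ k : ℝ) • s (ε⁻¹ * (y - x)) := fun y => by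
      simpa using htj 0 y
    have h7 : ∀ y, iteratedDeriv M t y =
        (ε ^ (k - M) : ℝ) • (Test.deriv^[M] s) (ε⁻¹ * (y - x)) := fun y => by
      rw [htj, Test.coe_deriv_iterate, pow_sub₀ _ hε'.ne' hk, inv_pow]
    simp only [h7] at h4
    simp only [h6] at h4
    rw [h4]
    ring
  · intro y hy hyx
    rw [jet_eq_zero fun hy' => ?_]
    · exact pairing_zero_right _
    · have := hrS ((Metric.closedBall_subset_closedBall (le_of_lt hεr)) (ht hy'))
      exact this (by simp [hy, hyx])

theorem exists_of_ord_le {F : Distr} {M : ℕ} (h : ord F ≤ M) :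
    ∃ n ≤ M, ∃ g : ℝ → ℂ, LocallyIntegrable g volume ∧ F = dDeriv^[n] (reg g) := by
  have hne : {N : ℕ∞ | ∃ (n : ℕ) (g : ℝ → ℂ), N = n ∧ LocallyIntegrable g volume ∧
      F = dDeriv^[n] (reg g)}.Nonempty := by
    by_contra hne
    rw [not_nonempty_iff_eq_empty] at hne
    rw [ord, hne, sInf_empty] at h
    exact absurd h (by simp)
  obtain ⟨n, g, hn, hg, hF⟩ := csInf_mem hne
  refine ⟨n, ?_, g, hg, hF⟩
  have h1 : ((n : ℕ) : ℕ∞) ≤ M := hn ▸ h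
  exact_mod_cast h1

theorem Rep.coeff_eq_zero_of_ord_le {c : ℝ → Polynomial ℂ} {F : Distr} (h : Rep S f c F) {M : ℕ}
    (hF : ord F ≤ M) (x : ℝ) {k : ℕ} (hk : M ≤ k) : (c x).coeff k = 0 := by
  obtain ⟨n, hn, g, hg, hFg⟩ := exists_of_ord_le hF
  exact h.coeff_eq_zero hg hFg x (hn.trans hk)

end

section

variable {S T : Finset ℝ} {f g : ℝ → ℂ} {c d : ℝ → Polynomial ℂ} {F G : Distr}

/-! ### The Hörmander product -/

/-- On the intersection of members of two covers, either the same factor is smooth for both covers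
and the two functions agree there, or both factors are smooth and both products are the pointwise
product. -/
theorem IsHormanderProd.unique {P Q : Distr} (hP : IsHormanderProd F G P)
    (hQ : IsHormanderProd F G Q) : P = Q := by
  obtain ⟨m, U, hU, hUc, hUP⟩ := hP
  obtain ⟨n, V, hV, hVc, hVQ⟩ := hQ
  refine Distr.eq_of_cover (ι := Fin m × Fin n) (U := fun i => U i.1 ∩ V i.2)
    (fun i => (hU i.1).inter (hV i.2)) ?_ ?_
  · refine eq_univ_of_forall fun x => ?_
    obtain ⟨i, hi⟩ := mem_iUnion.mp (hUc.ge (mem_univ x))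
    obtain ⟨j, hj⟩ := mem_iUnion.mp (hVc.ge (mem_univ x))
    exact mem_iUnion.mpr ⟨(i, j), hi, hj⟩
  · rintro ⟨i, j⟩ t ht
    have htU : tsupport t ⊆ U i := ht.trans inter_subset_left
    have htV : tsupport t ⊆ V j := ht.trans inter_subset_right
    obtain ⟨u, hu, hPi⟩ := hUP i
    obtain ⟨v, hv, hQj⟩ := hVQ j
    have hsame : ∀ {H : Distr}, EqFunOn H (U i) u → EqFunOn H (V j) v →
        mulTest (hU i) hu t htU = mulTest (hV j) hv t htV := by
      intro H h1 h2
      ext y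
      have h3 := eqOn_of_eqFunOn (hU i) (hV j) hu hv h1 h2
      simp only [coe_mulTest]
      by_cases hy : y ∈ tsupport t
      · rw [h3 (ht hy)]
      · rw [image_eq_zero_of_notMem_tsupport hy, mul_zero, mul_zero]
    have hmix : ∀ {H K : Distr}, EqFunOn H (U i) u → EqFunOn K (V j) v →
        K (mulTest (hU i) hu t htU) = H (mulTest (hV j) hv t htV) := by
      intro H K h1 h2
      rw [h2 _ ((tsupport_mulTest_subset _ hu t htU).trans htV),
        h1 _ ((tsupport_mulTest_subset _ hv t htV).trans htU)]
      simp only [coe_mulTest]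
      refine integral_congr_ae (Eventually.of_forall fun y => ?_)
      simp only
      ring
    rcases hPi with ⟨h1, h2⟩ | ⟨h1, h2⟩ <;> rcases hQj with ⟨h3, h4⟩ | ⟨h3, h4⟩
    · rw [h2 t htU, h4 t htV, hsame h1 h3]
    · rw [h2 t htU, h4 t htV, hmix h1 h3]
    · rw [h2 t htU, h4 t htV, hmix h1 h3]
    · rw [h2 t htU, h4 t htV, hsame h1 h3]

theorem hormander_eq {P : Distr} (hP : IsHormanderProd F G P) : hormander F G = P := by
  have h : ∃ P, IsHormanderProd F G P := ⟨P, hP⟩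
  rw [hormander, dif_pos h]
  exact h.choose_spec.unique hP

theorem jetMul_zero_right (u : ℕ → ℂ) : jetMul u 0 = 0 := by
  funext k; simp [jetMul]

theorem Rep.eqFunOn_compl (h : Rep S f c F) : EqFunOn F (S : Set ℝ)ᶜ f := by
  intro t ht
  rw [h.apply, Finset.sum_eq_zero, add_zero]
  intro x hx
  rw [jet_eq_zero fun hx' => ht hx' hx]
  exact pairing_zero_right _

/-- Evaluation of `F` on the product of a test function with the function part of `G`, when the
exceptional sets are disjoint. -/
theorem Rep.apply_mulTest (hF : Rep S f c F) (hG : PwSmooth T g) (hST : Disjoint S T) (t : Test)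
    (ht : tsupport t ⊆ (T : Set ℝ)ᶜ) :
    F (mulTest (isOpen_compl_finset T) hG.smooth t ht) =
      (∫ x, t x * (f x * g x)) + ∑ x ∈ S, pairing (c x) (jetMul (jet g x) (jet t x)) := by
  rw [hF.apply, coe_mulTest]
  congr 1
  · refine integral_congr_ae (Eventually.of_forall fun y => ?_)
    simp only
    ring
  · refine Finset.sum_congr rfl fun x hx => ?_
    rw [jet_mul (hG.contDiffAt (Finset.disjoint_left.mp hST hx)) t.contDiff.contDiffAt]

/-- The Hörmander product of two distributions in normal form with disjoint exceptional sets. -/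
theorem Rep.hormander_apply (hF : Rep S f c F) (hG : Rep T g d G) (hST : Disjoint S T)
    (t : Test) : hormander F G t = (∫ x, t x * (f x * g x)) +
      ∑ x ∈ S, pairing (c x) (jetMul (jet g x) (jet t x)) +
      ∑ x ∈ T, pairing (d x) (jetMul (jet f x) (jet t x)) := by
  classical
  have hfg : LocallyIntegrable (fun x => f x * g x) volume :=
    ((hF.pwSmooth.mono Finset.subset_union_left).mul
      (hG.pwSmooth.mono (Finset.subset_union_right (s₁ := S)))).locallyIntegrable
  set P : Distr := reg (fun x => f x * g x) + ∑ x ∈ S, pointDistr x (contract (c x) (jet g x)) +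
    ∑ x ∈ T, pointDistr x (contract (d x) (jet f x)) with hPdef
  have hPt : ∀ t : Test, P t = (∫ x, t x * (f x * g x)) +
      ∑ x ∈ S, pairing (c x) (jetMul (jet g x) (jet t x)) +
      ∑ x ∈ T, pairing (d x) (jetMul (jet f x) (jet t x)) := by
    intro t
    simp only [hPdef, add_apply, sum_apply, reg_apply hfg, pointDistr_apply, pairing_contract]
  have hzero : ∀ {R : Finset ℝ} {e : ℝ → Polynomial ℂ} {h : ℝ → ℂ} {t : Test},
      tsupport t ⊆ (R : Set ℝ)ᶜ → ∑ x ∈ R, pairing (e x) (jetMul (jet h x) (jet t x)) = 0 := by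
    intro R e h t ht
    refine Finset.sum_eq_zero fun x hx => ?_
    rw [jet_eq_zero fun hx' => ht hx' hx, jetMul_zero_right]
    exact pairing_zero_right _
  have hP : IsHormanderProd F G P := by
    refine ⟨2, ![(T : Set ℝ)ᶜ, (S : Set ℝ)ᶜ], fun i => ?_, ?_, fun i => ?_⟩
    · fin_cases i
      · exact isOpen_compl_finset T
      · exact isOpen_compl_finset S
    · refine eq_univ_of_forall fun x => mem_iUnion.mpr ?_
      by_cases hx : x ∈ T
      · exact ⟨1, fun hxS => Finset.disjoint_left.mp hST hxS hx⟩
      · exact ⟨0, hx⟩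
    · fin_cases i
      · refine ⟨g, hG.pwSmooth.smooth, Or.inl ⟨hG.eqFunOn_compl, fun t ht => ?_⟩⟩
        rw [hPt, hzero (R := T) ht, add_zero]
        exact (hF.apply_mulTest hG.pwSmooth hST t ht).symm
      · refine ⟨f, hF.pwSmooth.smooth, Or.inr ⟨hF.eqFunOn_compl, fun t ht => ?_⟩⟩
        rw [hPt, hzero (R := S) ht, add_zero]
        refine Eq.trans ?_ (hG.apply_mulTest hF.pwSmooth hST.symm t ht).symm
        simp only [mul_comm (f _)]
  rw [hormander_eq hP, hPt]

/-! ### Translation -/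

theorem coe_translateTest (ε : ℝ) (t : Test) : ⇑(translateTest ε t) = fun x => t (x - ε) := rfl

theorem jet_translateTest (ε : ℝ) (t : Test) (x : ℝ) :
    jet (translateTest ε t) x = jet t (x - ε) := by
  funext k
  rw [coe_translateTest, jet, jet]
  exact congrFun (iteratedDeriv_comp_sub_const (n := k) (f := t) (s := ε)) x

theorem tendsto_add_nhdsLT (x ε : ℝ) : Tendsto (fun y => y + ε) (𝓝[<] x) (𝓝[<] (x + ε)) :=
  tendsto_nhdsWithin_of_tendsto_nhds_of_eventually_within _
    ((continuous_add_const ε).continuousAt.mono_left nhdsWithin_le_nhds)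
    (by filter_upwards [self_mem_nhdsWithin] with y hy
        exact add_lt_add_left (show y < x from hy) ε)

theorem tendsto_add_nhdsGT (x ε : ℝ) : Tendsto (fun y => y + ε) (𝓝[>] x) (𝓝[>] (x + ε)) :=
  tendsto_nhdsWithin_of_tendsto_nhds_of_eventually_within _
    ((continuous_add_const ε).continuousAt.mono_left nhdsWithin_le_nhds)
    (by filter_upwards [self_mem_nhdsWithin] with y hy
        exact add_lt_add_left (show x < y from hy) ε)

theorem iteratedDeriv_translate (g : ℝ → ℂ) (ε : ℝ) (k : ℕ) :
    iteratedDeriv k (fun x => g (x + ε)) = fun x => iteratedDeriv k g (x + ε) :=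
  iteratedDeriv_comp_add_const (n := k) (f := g) (s := ε)

open Classical in
theorem PwSmooth.translate (hg : PwSmooth S g) (ε : ℝ) :
    PwSmooth (S.image fun x => x - ε) fun x => g (x + ε) where
  smooth := by
    refine hg.smooth.comp (contDiff_id.add contDiff_const).contDiffOn fun x hx hxS => hx ?_
    exact Finset.mem_coe.mpr (Finset.mem_image.mpr ⟨_, hxS, by simp⟩)
  left x k := by
    rw [iteratedDeriv_translate]
    exact ⟨_, (hg.tendsto_left (x + ε) k).comp (tendsto_add_nhdsLT x ε)⟩
  right x k := by
    rw [iteratedDeriv_translate]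
    exact ⟨_, (hg.tendsto_right (x + ε) k).comp (tendsto_add_nhdsGT x ε)⟩

open Classical in
theorem Rep.shiftDistr (hG : Rep S g d G) (ε : ℝ) :
    Rep (S.image fun x => x - ε) (fun x => g (x + ε)) (fun x => d (x + ε)) (shiftDistr ε G) where
  pwSmooth := hG.pwSmooth.translate ε
  eq_zero x hx := hG.eq_zero _ fun h => hx (Finset.mem_image.mpr ⟨_, h, by simp⟩)
  apply t := by
    have h1 : DistODE.shiftDistr ε G t = G (translateTest ε t) := rfl
    rw [h1, hG.apply, Finset.sum_image fun x _ y _ h => by simpa using h]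
    congr 1
    · rw [← integral_sub_right_eq_self (fun x => t x * g (x + ε)) ε]
      simp [coe_translateTest]
    · simp [jet_translateTest]

/-! ### The star product -/

theorem tendsto_const_add_nhdsGT (x : ℝ) :
    Tendsto (fun ε : ℝ => x + ε) (𝓝[>] 0) (𝓝[>] x) := by
  refine tendsto_nhdsWithin_of_tendsto_nhds_of_eventually_within _ ?_ ?_
  · have : Tendsto (fun ε : ℝ => x + ε) (𝓝 0) (𝓝 (x + 0)) := (continuous_const_add x).tendsto 0
    rw [add_zero] at this
    exact this.mono_left nhdsWithin_le_nhds
  · filter_upwards [self_mem_nhdsWithin] with ε hε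
    exact lt_add_of_pos_right x hε

theorem tendsto_const_sub_nhdsGT (x : ℝ) :
    Tendsto (fun ε : ℝ => x - ε) (𝓝[>] 0) (𝓝[<] x) := by
  refine tendsto_nhdsWithin_of_tendsto_nhds_of_eventually_within _ ?_ ?_
  · have : Tendsto (fun ε : ℝ => x - ε) (𝓝 0) (𝓝 (x - 0)) :=
      (continuous_const.sub continuous_id).tendsto 0
    rw [sub_zero] at this
    exact this.mono_left nhdsWithin_le_nhds
  · filter_upwards [self_mem_nhdsWithin] with ε hε
    exact sub_lt_self x hε

/-- Dominated convergence: `g (x + ε) → g x` off the finite set `S`. -/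
theorem tendsto_integral_translate (hf : PwSmooth S f) (hg : PwSmooth S g) (t : Test) :
    Tendsto (fun ε : ℝ => ∫ x, t x * (f x * g (x + ε))) (𝓝[>] 0)
      (𝓝 (∫ x, t x * (f x * g x))) := by
  have hK : IsCompact ((fun p : ℝ × ℝ => p.1 + p.2) '' (tsupport t ×ˢ Icc (0 : ℝ) 1)) :=
    (t.hasCompactSupport.isCompact.prod isCompact_Icc).image continuous_add
  obtain ⟨C, hC⟩ := hg.exists_bound hK
  refine tendsto_integral_filter_of_dominated_convergence (fun x => ‖t x * f x‖ * C) ?_ ?_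
    ((t.integrable_mul hf.locallyIntegrable).norm.mul_const C) ?_
  · classical
    exact Eventually.of_forall fun ε => (t.continuous.aestronglyMeasurable).mul
      (hf.aestronglyMeasurable.mul (hg.translate ε).aestronglyMeasurable)
  · filter_upwards [self_mem_nhdsWithin, mem_nhdsWithin_of_mem_nhds (gt_mem_nhds one_pos)]
      with ε hε hε1
    refine Eventually.of_forall fun x => ?_
    rw [← mul_assoc, norm_mul]
    by_cases hx : x ∈ tsupport t
    · exact mul_le_mul_of_nonneg_left
        (hC _ ⟨(x, ε), ⟨hx, le_of_lt hε, le_of_lt hε1⟩, rfl⟩) (norm_nonneg _)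
    · simp [image_eq_zero_of_notMem_tsupport hx]
  · filter_upwards [S.finite_toSet.countable.ae_notMem volume] with x hx
    refine ((Tendsto.const_mul _ ?_).const_mul _)
    exact (hg.contDiffAt hx).continuousAt.tendsto.comp
      ((tendsto_const_add_nhdsGT x).mono_right nhdsWithin_le_nhds)

theorem eventually_disjoint_image (S : Finset ℝ) [DecidableEq ℝ] :
    ∀ᶠ ε : ℝ in 𝓝[>] 0, Disjoint S (S.image fun x => x - ε) := by
  have h : ∀ᶠ ε : ℝ in 𝓝[>] 0, ∀ x ∈ S, ∀ y ∈ S, x ≠ y - ε := by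
    refine (Filter.eventually_all_finset S).mpr fun x _ =>
      (Filter.eventually_all_finset S).mpr fun y _ => ?_
    rcases le_or_gt y x with hxy | hxy
    · filter_upwards [self_mem_nhdsWithin] with ε hε h
      have : (0 : ℝ) < ε := hε
      linarith
    · filter_upwards [mem_nhdsWithin_of_mem_nhds (gt_mem_nhds (sub_pos.mpr hxy))] with ε hε h
      have : ε < y - x := hε
      linarith
  filter_upwards [h] with ε hε
  rw [Finset.disjoint_left]
  intro x hx hx'
  obtain ⟨y, hy, hyx⟩ := Finset.mem_image.mp hx'
  exact hε x hx y hy hyx.symm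

theorem tendsto_sum_pairing_right (hg : PwSmooth S g) (c : ℝ → Polynomial ℂ) (t : Test) :
    Tendsto (fun ε : ℝ => ∑ x ∈ S, pairing (c x) (jetMul (jet g (x + ε)) (jet t x))) (𝓝[>] 0)
      (𝓝 (∑ x ∈ S, pairing (c x) (jetMul (rightJet g x) (jet t x)))) := by
  refine tendsto_finsetSum _ fun x _ => tendsto_pairing (fun k => ?_) _
  exact tendsto_jetMul (u := fun ε : ℝ => jet g (x + ε)) (v := fun _ => jet t x)
    (fun k => (hg.tendsto_right x k).comp (tendsto_const_add_nhdsGT x))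
    (fun _ => tendsto_const_nhds) k

theorem tendsto_sum_pairing_left (hf : PwSmooth S f) (d : ℝ → Polynomial ℂ) (t : Test) :
    Tendsto (fun ε : ℝ => ∑ x ∈ S, pairing (d x) (jetMul (jet f (x - ε)) (jet t (x - ε))))
      (𝓝[>] 0) (𝓝 (∑ x ∈ S, pairing (d x) (jetMul (leftJet f x) (jet t x)))) := by
  refine tendsto_finsetSum _ fun x _ => tendsto_pairing (fun k => ?_) _
  exact tendsto_jetMul (u := fun ε : ℝ => jet f (x - ε)) (v := fun ε : ℝ => jet t (x - ε))
    (fun k => (hf.tendsto_left x k).comp (tendsto_const_sub_nhdsGT x))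
    (fun k => ((tendsto_iteratedDeriv t.contDiff.contDiffAt k).mono_left
      nhdsWithin_le_nhds).comp (tendsto_const_sub_nhdsGT x)) k

theorem Rep.hormander_shiftDistr_apply [DecidableEq ℝ] (hF : Rep S f c F) (hG : Rep S g d G)
    (t : Test) {ε : ℝ} (hε : Disjoint S (S.image fun x => x - ε)) :
    hormander F (DistODE.shiftDistr ε G) t = (∫ x, t x * (f x * g (x + ε))) +
        ∑ x ∈ S, pairing (c x) (jetMul (jet g (x + ε)) (jet t x)) +
        ∑ x ∈ S, pairing (d x) (jetMul (jet f (x - ε)) (jet t (x - ε))) := by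
  have hG' : Rep (S.image fun x => x - ε) (fun x => g (x + ε)) (fun x => d (x + ε))
      (DistODE.shiftDistr ε G) := by
    convert hG.shiftDistr ε
  have hinj : ∀ x ∈ S, ∀ y ∈ S, x - ε = y - ε → x = y := fun x _ y _ h => by simpa using h
  have h1 : ∀ x, jet (fun y => g (y + ε)) x = jet g (x + ε) := fun x =>
    funext fun k => congrFun (iteratedDeriv_translate g ε k) x
  rw [hF.hormander_apply hG' hε, Finset.sum_image hinj]
  simp only [h1, sub_add_cancel]

theorem Rep.isStarProd (hF : Rep S f c F) (hG : Rep S g d G) {P : Distr}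
    (hP : ∀ t : Test, P t = (∫ x, t x * (f x * g x)) +
      ∑ x ∈ S, pairing (c x) (jetMul (rightJet g x) (jet t x)) +
      ∑ x ∈ S, pairing (d x) (jetMul (leftJet f x) (jet t x))) : IsStarProd F G P := by
  classical
  intro t
  rw [hP]
  refine (((tendsto_integral_translate hF.pwSmooth hG.pwSmooth t).add
    (tendsto_sum_pairing_right hG.pwSmooth c t)).add
    (tendsto_sum_pairing_left hF.pwSmooth d t)).congr' ?_
  filter_upwards [eventually_disjoint_image S] with ε hε
  exact (hF.hormander_shiftDistr_apply hG t hε).symm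

/-- The product `F ⋆ G` of two distributions in normal form. Since the singularities of the
translates of `G` approach those of `F` from the left, the point parts of `F` are multiplied by the
right-sided jets of the function part of `G`, and the point parts of `G` by the left-sided jets of
the function part of `F`. -/
theorem Rep.starProd_apply (hF : Rep S f c F) (hG : Rep S g d G) (t : Test) :
    (F ⋆ G) t = (∫ x, t x * (f x * g x)) +
      ∑ x ∈ S, pairing (contract (c x) (rightJet g x) + contract (d x) (leftJet f x)) (jet t x) := by
  have hfg := (hF.pwSmooth.mul hG.pwSmooth).locallyIntegrable
  set P : Distr := reg (fun x => f x * g x) + ∑ x ∈ S, pointDistr x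
    (contract (c x) (rightJet g x) + contract (d x) (leftJet f x)) with hPdef
  have hPt : ∀ t : Test, P t = (∫ x, t x * (f x * g x)) +
      ∑ x ∈ S, pairing (contract (c x) (rightJet g x) + contract (d x) (leftJet f x))
        (jet t x) := by
    intro t
    simp only [hPdef, add_apply, sum_apply, reg_apply hfg, pointDistr_apply]
  have hP : IsStarProd F G P := by
    refine hF.isStarProd hG fun t => ?_
    rw [hPt, add_assoc, ← Finset.sum_add_distrib]
    simp only [pairing_add, pairing_contract]
  have h : ∃ P, IsStarProd F G P := ⟨P, hP⟩
  rw [starProd, dif_pos h, tendsto_nhds_unique (h.choose_spec t) (hP t), hPt]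

end

section

variable {S T : Finset ℝ} {f g : ℝ → ℂ} {c d : ℝ → Polynomial ℂ} {F G : Distr}

/-! ### Smooth extension to the closure of an interval -/

open Classical in
/-- The `k`-th derivative of the extension of `f|_Ω` to the closure of the open interval `Ω`: the
right limit of the `k`-th derivative of `f`, except at the right end of `Ω`, where it is the left
limit. -/
noncomputable def jetExt (Ω : Set ℝ) (f : ℝ → ℂ) (k : ℕ) (x : ℝ) : ℂ :=
  if Ω ∈ 𝓝[>] x then rightJet f x k else leftJet f x k

/-- A point of the closure of an interval is approached from the left inside the interval, or it is
the left end. -/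
theorem mem_nhdsLT_or {Ω : Set ℝ} (hΩ : Ω.OrdConnected) {x : ℝ} (hx : x ∈ closure Ω) :
    Ω ∈ 𝓝[<] x ∨ closure Ω ⊆ Ici x := by
  by_cases h : ∃ y ∈ Ω, y < x
  · obtain ⟨y, hy, hyx⟩ := h
    left
    filter_upwards [Ioo_mem_nhdsLT hyx] with z hz
    obtain ⟨w, hw, hwΩ⟩ := mem_closure_iff.mp hx (Ioi z) isOpen_Ioi hz.2
    exact hΩ.out hy hwΩ ⟨hz.1.le, le_of_lt hw⟩
  · right
    push Not at h
    exact closure_minimal h isClosed_Ici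

theorem mem_nhdsGT_or {Ω : Set ℝ} (hΩ : Ω.OrdConnected) {x : ℝ} (hx : x ∈ closure Ω) :
    Ω ∈ 𝓝[>] x ∨ closure Ω ⊆ Iic x := by
  by_cases h : ∃ y ∈ Ω, x < y
  · obtain ⟨y, hy, hyx⟩ := h
    left
    filter_upwards [Ioo_mem_nhdsGT hyx] with z hz
    obtain ⟨w, hw, hwΩ⟩ := mem_closure_iff.mp hx (Iio z) isOpen_Iio hz.1
    exact hΩ.out hwΩ hy ⟨le_of_lt hw, hz.2.le⟩
  · right
    push Not at h
    exact closure_minimal h isClosed_Iic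

theorem jetExt_of_mem {Ω : Set ℝ} (ho : IsOpen Ω) {x : ℝ} (hx : x ∈ Ω) (k : ℕ) :
    jetExt Ω f k x = rightJet f x k :=
  if_pos (mem_nhdsWithin_of_mem_nhds (ho.mem_nhds hx))

theorem PwSmooth.jetExt_eq (hf : PwSmooth S f) {Ω : Set ℝ} (ho : IsOpen Ω) {x : ℝ} (hx : x ∈ Ω)
    (hxS : x ∉ S) (k : ℕ) : jetExt Ω f k x = iteratedDeriv k f x := by
  rw [jetExt_of_mem ho hx, rightJet_eq_of_contDiffAt (hf.contDiffAt hxS), jet]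

theorem PwSmooth.jetExt_eventuallyEq (hf : PwSmooth S f) {Ω : Set ℝ} (ho : IsOpen Ω) {x : ℝ}
    (hx : x ∈ Ω) (hxS : x ∉ S) (k : ℕ) : jetExt Ω f k =ᶠ[𝓝 x] iteratedDeriv k f := by
  filter_upwards [ho.mem_nhds hx, (isOpen_compl_finset S).mem_nhds (show x ∈ (S : Set ℝ)ᶜ from hxS)]
    with y hy hyS
  exact hf.jetExt_eq ho hy hyS k

/-- If `Ω` lies on both sides of `x`, then `x ∈ Ω`, where the one-sided jets agree. -/
theorem leftJet_eq_jetExt {Ω : Set ℝ} (hΩ : Ω.OrdConnected)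
    (hJ : ∀ x ∈ Ω, leftJet f x = rightJet f x) {x : ℝ} (hx : Ω ∈ 𝓝[<] x) (k : ℕ) :
    leftJet f x k = jetExt Ω f k x := by
  rw [jetExt]
  split_ifs with h
  · obtain ⟨y, hy, hyx⟩ := (Filter.inter_mem hx self_mem_nhdsWithin |> Filter.nonempty_of_mem)
    obtain ⟨z, hz, hzx⟩ := (Filter.inter_mem h self_mem_nhdsWithin |> Filter.nonempty_of_mem)
    rw [hJ x (hΩ.out hy hz ⟨le_of_lt hyx, le_of_lt hzx⟩)]
  · rfl

theorem PwSmooth.hasDerivWithinAt_jetExt (hf : PwSmooth S f) {Ω : Set ℝ} (ho : IsOpen Ω)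
    (hΩ : Ω.OrdConnected) (hJ : ∀ x ∈ Ω, leftJet f x = rightJet f x) (k : ℕ) {x : ℝ}
    (hx : x ∈ closure Ω) :
    HasDerivWithinAt (jetExt Ω f k) (jetExt Ω f (k + 1) x) (closure Ω) x := by
  have hderiv : ∀ y ∈ Ω, y ∉ S →
      HasDerivAt (jetExt Ω f k) (iteratedDeriv (k + 1) f y) y := fun y hy hyS =>
    (hasDerivAt_iteratedDeriv (hf.contDiffAt hyS) k).congr_of_eventuallyEq
      (hf.jetExt_eventuallyEq ho hy hyS k)
  have hdiff : DifferentiableOn ℝ (jetExt Ω f k) (Ω \ S) := fun y hy =>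
    (hderiv y hy.1 hy.2).differentiableAt.differentiableWithinAt
  have hleft : HasDerivWithinAt (jetExt Ω f k) (jetExt Ω f (k + 1) x) (closure Ω ∩ Iic x) x := by
    rcases mem_nhdsLT_or hΩ hx with h | h
    · refine HasDerivWithinAt.mono ?_ inter_subset_right
      have hs : (Ω \ S) ∩ Iio x ∈ 𝓝[<] x := by
        filter_upwards [h, eventually_left_notMem S x, self_mem_nhdsWithin] with y h1 h2 h3
        exact ⟨⟨h1, h2⟩, h3⟩
      refine hasDerivWithinAt_Iic_of_tendsto_deriv (hdiff.mono inter_subset_left) ?_ hs ?_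
      · rw [ContinuousWithinAt, ← leftJet_eq_jetExt hΩ hJ h]
        refine ((hf.tendsto_left x k).mono_left (nhdsWithin_mono x inter_subset_right)).congr' ?_
        filter_upwards [self_mem_nhdsWithin] with y hy
        exact (hf.jetExt_eq ho hy.1.1 hy.1.2 k).symm
      · rw [← leftJet_eq_jetExt hΩ hJ h]
        refine (hf.tendsto_left x (k + 1)).congr' ?_
        filter_upwards [hs] with y hy
        exact (hderiv y hy.1.1 hy.1.2).deriv.symm
    · exact HasFDerivWithinAt.of_subsingleton fun y hy z hz =>
        (le_antisymm hy.2 (h hy.1)).trans (le_antisymm hz.2 (h hz.1)).symm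
  have hright : HasDerivWithinAt (jetExt Ω f k) (jetExt Ω f (k + 1) x) (closure Ω ∩ Ici x) x := by
    rcases mem_nhdsGT_or hΩ hx with h | h
    · refine HasDerivWithinAt.mono ?_ inter_subset_right
      have hs : (Ω \ S) ∩ Ioi x ∈ 𝓝[>] x := by
        filter_upwards [h, eventually_right_notMem S x, self_mem_nhdsWithin] with y h1 h2 h3
        exact ⟨⟨h1, h2⟩, h3⟩
      have hE : ∀ j, jetExt Ω f j x = rightJet f x j := fun j => if_pos h
      refine hasDerivWithinAt_Ici_of_tendsto_deriv (hdiff.mono inter_subset_left) ?_ hs ?_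
      · rw [ContinuousWithinAt, hE]
        refine ((hf.tendsto_right x k).mono_left (nhdsWithin_mono x inter_subset_right)).congr' ?_
        filter_upwards [self_mem_nhdsWithin] with y hy
        exact (hf.jetExt_eq ho hy.1.1 hy.1.2 k).symm
      · rw [hE]
        refine (hf.tendsto_right x (k + 1)).congr' ?_
        filter_upwards [hs] with y hy
        exact (hderiv y hy.1.1 hy.1.2).deriv.symm
    · exact HasFDerivWithinAt.of_subsingleton fun y hy z hz =>
        (le_antisymm (h hy.1) hy.2).trans (le_antisymm (h hz.1) hz.2).symm
  refine (hleft.union hright).mono fun y hy => ?_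
  rcases le_total y x with h | h
  · exact Or.inl ⟨hy, h⟩
  · exact Or.inr ⟨hy, h⟩

theorem uniqueDiffOn_closure {Ω : Set ℝ} (ho : IsOpen Ω) (hΩ : Ω.OrdConnected) :
    UniqueDiffOn ℝ (closure Ω) := by
  rcases Ω.eq_empty_or_nonempty with rfl | hne
  · simpa using uniqueDiffOn_empty
  · exact uniqueDiffOn_convex hΩ.convex.closure
      (hne.mono (interior_maximal subset_closure ho))

/-- If the one-sided jets of the piecewise smooth function `f` agree at all points of the open
interval `Ω`, then `f|_Ω` extends smoothly to the closure of `Ω`. -/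
theorem PwSmooth.iteratedDerivWithin_jetExt (hf : PwSmooth S f) {Ω : Set ℝ} (ho : IsOpen Ω)
    (hΩ : Ω.OrdConnected) (hJ : ∀ x ∈ Ω, leftJet f x = rightJet f x) (k : ℕ) :
    EqOn (iteratedDerivWithin k (jetExt Ω f 0) (closure Ω)) (jetExt Ω f k) (closure Ω) := by
  induction k with
  | zero => intro x _; simp
  | succ k ih =>
    intro x hx
    rw [iteratedDerivWithin_succ, derivWithin_congr ih (ih hx)]
    exact (hf.hasDerivWithinAt_jetExt ho hΩ hJ k hx).derivWithin (uniqueDiffOn_closure ho hΩ x hx)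

theorem PwSmooth.contDiffOn_jetExt (hf : PwSmooth S f) {Ω : Set ℝ} (ho : IsOpen Ω)
    (hΩ : Ω.OrdConnected) (hJ : ∀ x ∈ Ω, leftJet f x = rightJet f x) :
    ContDiffOn ℝ ∞ (jetExt Ω f 0) (closure Ω) := by
  refine contDiffOn_of_differentiableOn_deriv (n := ⊤) fun k _ => ?_
  refine DifferentiableOn.congr (f := jetExt Ω f k) (fun x hx => ?_)
    (hf.iteratedDerivWithin_jetExt ho hΩ hJ k)
  exact (hf.hasDerivWithinAt_jetExt ho hΩ hJ k hx).differentiableWithinAt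

/-! ### Singular supports and lateral values in normal form -/

theorem Rep.eq_zero_and_jet_eq (h : Rep S f c F) {x : ℝ} (hx : x ∉ singSupp F) :
    c x = 0 ∧ leftJet f x = rightJet f x := by
  rw [singSupp, notMem_compl_iff] at hx
  obtain ⟨U, ⟨hU, g, hg, hFg⟩, hxU⟩ := hx
  obtain ⟨h1, h2⟩ := h.eq_of_eqFunOn hU hg hFg
  have hgx : ContDiffAt ℝ ∞ g x := hg.contDiffAt (hU.mem_nhds hxU)
  refine ⟨h2 x hxU, ?_⟩
  rw [leftJet_congr (g := g), rightJet_congr (g := g), leftJet_eq_of_contDiffAt hgx,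
    rightJet_eq_of_contDiffAt hgx]
  · filter_upwards [eventually_right_notMem S x, mem_nhdsWithin_of_mem_nhds (hU.mem_nhds hxU)]
      with y hy hyU
    exact h1 y hyU hy
  · filter_upwards [eventually_left_notMem S x, mem_nhdsWithin_of_mem_nhds (hU.mem_nhds hxU)]
      with y hy hyU
    exact h1 y hyU hy

theorem PwSmooth.ae_jetExt_eq (hf : PwSmooth S f) {Ω : Set ℝ} (ho : IsOpen Ω) :
    ∀ᵐ x, x ∈ Ω → jetExt Ω f 0 x = f x := by
  filter_upwards [S.finite_toSet.countable.ae_notMem volume] with x hx hxΩ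
  rw [hf.jetExt_eq ho hxΩ hx, iteratedDeriv_zero]

theorem Rep.isSmoothExt (h : Rep S f c F) {Ω : Set ℝ} (ho : IsOpen Ω) (hΩ : Ω.OrdConnected)
    (hd : Disjoint Ω (singSupp F)) : IsSmoothExt F Ω (jetExt Ω f 0) := by
  have hx : ∀ x ∈ Ω, x ∉ singSupp F := fun x hx => disjoint_left.mp hd hx
  refine ⟨h.pwSmooth.contDiffOn_jetExt ho hΩ fun x hxΩ => (h.eq_zero_and_jet_eq (hx x hxΩ)).2,
    fun t ht => ?_⟩
  rw [h.apply, Finset.sum_eq_zero, add_zero]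
  · refine integral_congr_ae ?_
    filter_upwards [h.pwSmooth.ae_jetExt_eq ho] with x hxe
    by_cases hxΩ : x ∈ Ω
    · rw [hxe hxΩ]
    · rw [image_eq_zero_of_notMem_tsupport fun hxt => hxΩ (ht hxt), zero_mul, zero_mul]
  · intro x _
    by_cases hxΩ : x ∈ Ω
    · rw [(h.eq_zero_and_jet_eq (hx x hxΩ)).1, pairing_zero]
    · rw [jet_eq_zero fun hxt => hxΩ (ht hxt)]
      exact pairing_zero_right _

theorem Rep.isLeftValue (h : Rep S f c F) (x : ℝ) : IsLeftValue F x (leftJet f x 0) := by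
  obtain ⟨y, hy, hyS⟩ := mem_nhdsLT_iff_exists_Ioo_subset.mp (eventually_left_notMem S x)
  refine ⟨y, hy, f, h.pwSmooth.smooth.mono hyS, fun t ht => h.eqFunOn_compl t (ht.trans hyS), ?_⟩
  simpa using h.pwSmooth.tendsto_left x 0

theorem Rep.isRightValue (h : Rep S f c F) (x : ℝ) : IsRightValue F x (rightJet f x 0) := by
  obtain ⟨y, hy, hyS⟩ := mem_nhdsGT_iff_exists_Ioo_subset.mp (eventually_right_notMem S x)
  refine ⟨y, hy, f, h.pwSmooth.smooth.mono hyS, fun t ht => h.eqFunOn_compl t (ht.trans hyS), ?_⟩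
  simpa using h.pwSmooth.tendsto_right x 0

/-! ### Gaps -/

theorem isOpen_gap {m : ℕ} (ξ : Fin m → ℝ) (k : Fin (m + 1)) : IsOpen (gap ξ k) := by
  simp only [gap, ofPred_and, ofPred_forall]
  refine IsOpen.inter ?_ ?_
  · exact isOpen_iInter_of_finite fun j => isOpen_iInter_of_finite fun _ => isOpen_Ioi
  · exact isOpen_iInter_of_finite fun j => isOpen_iInter_of_finite fun _ => isOpen_Iio

theorem ordConnected_gap {m : ℕ} (ξ : Fin m → ℝ) (k : Fin (m + 1)) : (gap ξ k).OrdConnected :=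
  ⟨fun _ hx _ hy _ hz => ⟨fun j hj => (hx.1 j hj).trans_le hz.1,
    fun j hj => hz.2.trans_lt (hy.2 j hj)⟩⟩

theorem disjoint_gap_range {m : ℕ} (ξ : Fin m → ℝ) (k : Fin (m + 1)) :
    Disjoint (gap ξ k) (range ξ) := by
  rw [disjoint_left]
  rintro _ hx ⟨j, rfl⟩
  rcases lt_or_ge (j : ℕ) k with h | h
  · exact lt_irrefl _ (hx.1 j h)
  · exact lt_irrefl _ (hx.2 j h)

theorem gap_unique {m : ℕ} {ξ : Fin m → ℝ} {k l : Fin (m + 1)} {x : ℝ} (hk : x ∈ gap ξ k)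
    (hl : x ∈ gap ξ l) : k = l := by
  have key : ∀ {k l : Fin (m + 1)}, x ∈ gap ξ k → x ∈ gap ξ l → ¬ k < l := by
    intro k l hk hl hkl
    have h1 : (k : ℕ) < l := hkl
    have h2 : (k : ℕ) < m := by have := l.is_lt; lia
    exact lt_asymm (hk.2 ⟨k, h2⟩ le_rfl) (hl.1 ⟨k, h2⟩ h1)
  exact le_antisymm (not_lt.mp (key hl hk)) (not_lt.mp (key hk hl))

theorem exists_mem_gap {m : ℕ} {ξ : Fin m → ℝ} (hξ : StrictMono ξ) {x : ℝ} (hx : x ∉ range ξ) :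
    ∃ k, x ∈ gap ξ k := by
  classical
  -- the gap of `x` is the least `k` such that all `ξ j` with `k ≤ j` lie on the right of `x`
  have h : ∃ k : ℕ, ∀ j : Fin m, k ≤ j → x < ξ j := ⟨m, fun j hj => absurd j.is_lt hj.not_gt⟩
  have hm : Nat.find h ≤ m := Nat.find_min' h fun j hj => absurd j.is_lt hj.not_gt
  refine ⟨⟨Nat.find h, Nat.lt_succ_of_le hm⟩, fun j hj => ?_, Nat.find_spec h⟩
  have h1 := Nat.find_min h hj
  push Not at h1
  obtain ⟨i, hji, hi⟩ := h1
  exact lt_of_le_of_ne ((hξ.monotone hji).trans hi) fun h => hx ⟨j, h⟩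

end

/-! ### The equation in normal form -/

section Equation

variable {n : ℕ} {a b : Fin (n + 1) → Distr} {f p : ℝ → ℂ} {ψ : Distr} {S : Finset ℝ}
  {α β : Fin (n + 1) → ℝ → ℂ} {A B : Fin (n + 1) → ℝ → Polynomial ℂ} {c : ℝ → Polynomial ℂ}

/-- The equation splits into an equation of functions off the exceptional set and, at every point,
an equation of point functionals. -/
theorem IsSolution.normalForm (ha : ∀ i, Rep S (α i) (A i) (a i))
    (hb : ∀ i, Rep S (β i) (B i) (b i)) (hp : Rep S p c ψ) (hf : ContDiff ℝ ∞ f)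
    (hψ : IsSolution a b f ψ) :
    (∀ x ∉ S, ∑ i : Fin (n + 1), (α i x + β i x) * iteratedDeriv i p x = f x) ∧
    ∀ x, ∑ i : Fin (n + 1), contract (derivCoeff S p c i x) (leftJet (α i) x + rightJet (β i) x) +
      ∑ i : Fin (n + 1), (contract (A i x) (rightJet (iteratedDeriv i p) x) +
        contract (B i x) (leftJet (iteratedDeriv i p) x)) = 0 := by
  have hpi : ∀ i : Fin (n + 1), PwSmooth S fun x => (α i x + β i x) * iteratedDeriv i p x :=
    fun i => ((ha i).pwSmooth.add (hb i).pwSmooth).mul (hp.pwSmooth.pwSmooth_iteratedDeriv i)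
  have hsum := (PwSmooth.sum (s := Finset.univ) fun i _ => hpi i).1
  have hfs : PwSmooth S f := PwSmooth.of_contDiff hf
  set e : Fin (n + 1) → ℝ → Polynomial ℂ := fun i x =>
    contract (derivCoeff S p c i x) (leftJet (α i) x + rightJet (β i) x) +
      (contract (A i x) (rightJet (iteratedDeriv i p) x) +
        contract (B i x) (leftJet (iteratedDeriv i p) x)) with he
  have hterm : ∀ (i : Fin (n + 1)) (t : Test),
      (a i ⋆ (dDeriv^[(i : ℕ)] ψ) + (dDeriv^[(i : ℕ)] ψ) ⋆ b i) t =
        (∫ x, t x * ((α i x + β i x) * iteratedDeriv i p x)) +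
          ∑ x ∈ S, pairing (e i x) (jet t x) := by
    intro i t
    have hd := hp.dDeriv_iterate i
    rw [add_apply, (ha i).starProd_apply hd, hd.starProd_apply (hb i)]
    have h1 : ∫ x, t x * ((α i x + β i x) * iteratedDeriv i p x) =
        (∫ x, t x * (α i x * iteratedDeriv i p x)) +
          ∫ x, t x * (iteratedDeriv i p x * β i x) := by
      rw [← integral_add
        (t.integrable_mul ((ha i).pwSmooth.mul hd.pwSmooth).locallyIntegrable)
        (t.integrable_mul (hd.pwSmooth.mul (hb i).pwSmooth).locallyIntegrable)]
      refine integral_congr_ae (Eventually.of_forall fun x => ?_)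
      simp only
      ring
    rw [h1, add_add_add_comm, ← Finset.sum_add_distrib]
    congr 1
    refine Finset.sum_congr rfl fun x _ => ?_
    simp only [he, contract_add_right, pairing_add]
    ring
  have hloc := local_vanishing (S := S) isOpen_univ
    (h := fun x => (∑ i : Fin (n + 1), (α i x + β i x) * iteratedDeriv i p x) - f x)
    (e := fun x => ∑ i, e i x) ?_ fun t _ => ?_
  · refine ⟨fun x hx => sub_eq_zero.mp (hloc.1 x (mem_univ x) hx), fun x => ?_⟩
    rw [← Finset.sum_add_distrib]
    by_cases hx : x ∈ S
    · exact hloc.2 x hx (mem_univ x)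
    · refine Finset.sum_eq_zero fun i _ => ?_
      rw [(hp.dDeriv_iterate i).eq_zero x hx, (ha i).eq_zero x hx, (hb i).eq_zero x hx]
      simp
  · exact (hsum.smooth.continuousOn.sub hf.continuous.continuousOn).mono fun x hx => hx.2
  · have h1 := congrArg (fun P : Distr => P t) hψ.2
    simp only [sum_apply, reg_apply hf.continuous.locallyIntegrable, hterm] at h1
    rw [Finset.sum_add_distrib, ← integral_finsetSum _ fun i _ =>
      t.integrable_mul (hpi i).locallyIntegrable, Finset.sum_comm] at h1
    simp only [mul_sub, pairing_sum]
    rw [integral_sub (t.integrable_mul hsum.locallyIntegrable)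
      (t.integrable_mul hfs.locallyIntegrable), ← h1]
    simp only [Finset.mul_sum]
    ring

/-- One-sided limits of all derivatives of the equation of functions. -/
theorem sum_jetMul_eq (ha : ∀ i, PwSmooth S (α i)) (hb : ∀ i, PwSmooth S (β i))
    (hp : PwSmooth S p) (hf : ContDiff ℝ ∞ f)
    (h : ∀ x ∉ S, ∑ i : Fin (n + 1), (α i x + β i x) * iteratedDeriv i p x = f x) (x : ℝ) :
    (∑ i : Fin (n + 1), jetMul (leftJet (α i) x + leftJet (β i) x)
      (leftJet (iteratedDeriv i p) x) = jet f x) ∧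
    ∑ i : Fin (n + 1), jetMul (rightJet (α i) x + rightJet (β i) x)
      (rightJet (iteratedDeriv i p) x) = jet f x := by
  have hab : ∀ i, PwSmooth S fun x => α i x + β i x := fun i => (ha i).add (hb i)
  have hpi : ∀ i : Fin (n + 1), PwSmooth S (iteratedDeriv i p) := fun i =>
    hp.pwSmooth_iteratedDeriv i
  obtain ⟨-, h2, h3⟩ := PwSmooth.sum (s := Finset.univ) fun i _ => (hab i).mul (hpi i)
  constructor
  · rw [← leftJet_eq_of_contDiffAt hf.contDiffAt, leftJet_congr
      (g := fun x => ∑ i : Fin (n + 1), (α i x + β i x) * iteratedDeriv i p x), h2]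
    · refine Finset.sum_congr rfl fun i _ => ?_
      rw [(hab i).leftJet_mul (hpi i), (ha i).leftJet_add (hb i)]
    · filter_upwards [eventually_left_notMem S x] with y hy
      exact (h y hy).symm
  · rw [← rightJet_eq_of_contDiffAt hf.contDiffAt, rightJet_congr
      (g := fun x => ∑ i : Fin (n + 1), (α i x + β i x) * iteratedDeriv i p x), h3]
    · refine Finset.sum_congr rfl fun i _ => ?_
      rw [(hab i).rightJet_mul (hpi i), (ha i).rightJet_add (hb i)]
    · filter_upwards [eventually_right_notMem S x] with y hy
      exact (h y hy).symm

theorem jetMul_sub (u v w : ℕ → ℂ) : jetMul u (v - w) = jetMul u v - jetMul u w := by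
  funext k
  simp only [jetMul, Pi.sub_apply, mul_sub, Finset.sum_sub_distrib]

/-- If the jumps of all derivatives satisfy the differentiated homogeneous equation, whose leading
coefficient does not vanish, and the first `n` of them are zero, then all of them are zero. -/
theorem jump_eq_zero {u : Fin (n + 1) → ℕ → ℂ} {J : ℕ → ℂ}
    (h : ∑ i : Fin (n + 1), jetMul (u i) (fun j => J (j + i)) = 0) (hu : u (Fin.last n) 0 ≠ 0)
    (h0 : ∀ l < n, J l = 0) (l : ℕ) : J l = 0 := by
  induction l using Nat.strong_induction_on with
  | _ l ih =>
    rcases lt_or_ge l n with hl | hl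
    · exact h0 l hl
    obtain ⟨k, rfl⟩ := Nat.exists_eq_add_of_le hl
    have h1 := congrFun h k
    rw [Finset.sum_apply, Fin.sum_univ_castSucc, Finset.sum_eq_zero, zero_add, jetMul,
      Finset.sum_range_succ', Finset.sum_eq_zero, zero_add] at h1
    · have h2 : k - 0 + n = n + k := by lia
      rw [← h2]
      simpa [hu] using h1
    · intro q hq
      have hqk : q < k := Finset.mem_range.mp hq
      simp only [Fin.val_last]
      rw [ih _ (by lia), mul_zero]
    · intro i _
      rw [jetMul]
      refine Finset.sum_eq_zero fun q _ => ?_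
      have hi : (i : ℕ) < n := i.is_lt
      simp only [Fin.val_castSucc]
      rw [ih _ (by lia), mul_zero]

/-- The bound for the order of the point part of a solution. -/
theorem coeff_eq_zero_of_equation {x : ℝ} {E : Polynomial ℂ} {w : Fin (n + 1) → ℕ → ℂ} {M : ℕ}
    (heq : ∑ i : Fin (n + 1), contract (derivCoeff S p c i x) (w i) + E = 0)
    (hE : ∀ j, M ≤ j → E.coeff j = 0) (hw : w (Fin.last n) 0 ≠ 0) {j : ℕ} (hj : M ≤ j + n) :
    (c x).coeff j = 0 := by
  refine (isDerivSeq_derivCoeff S p c x).coeff_zero_of_le (w := fun i => w (Fin.ofNat (n + 1) i))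
    (n := n) (E := E) ?_ hE ?_ hj
  · rw [Finset.sum_range]
    simpa using heq
  · simpa [Fin.ofNat_eq_cast, Fin.natCast_eq_last] using hw

theorem jump_eq_zero_of_equation {x : ℝ} {w : Fin (n + 1) → ℕ → ℂ}
    (heq : ∑ i : Fin (n + 1), contract (derivCoeff S p c i x) (w i) = 0)
    (hw : w (Fin.last n) 0 ≠ 0) {l : ℕ} (hl : l < n) : rightJet p x l - leftJet p x l = 0 := by
  have key : ∀ {i : ℕ}, i ≤ n → derivCoeff S p c i x = 0 := fun hi =>
    (isDerivSeq_derivCoeff S p c x).jump_eq_zero (w := fun i => w (Fin.ofNat (n + 1) i)) (n := n)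
      (by rw [Finset.sum_range]; simpa using heq)
      (by simpa [Fin.ofNat_eq_cast, Fin.natCast_eq_last] using hw) hi
  have h1 : derivCoeff S p c (l + 1) x = 0 := key hl
  rw [derivCoeff, key hl.le] at h1
  rw [← Polynomial.C_eq_zero]
  simpa using h1

end Equation

theorem reg_indicator_jetExt_apply {S : Finset ℝ} {p : ℝ → ℂ} (hp : PwSmooth S p) {Ω : Set ℝ}
    (ho : IsOpen Ω) (t : Test) :
    reg (Ω.indicator (jetExt Ω p 0)) t = ∫ x, t x * Ω.indicator p x ∧
      Integrable fun x => t x * Ω.indicator p x := by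
  have hae : Ω.indicator p =ᵐ[volume] Ω.indicator (jetExt Ω p 0) := by
    filter_upwards [hp.ae_jetExt_eq ho] with x hx
    by_cases hxΩ : x ∈ Ω
    · rw [indicator_of_mem hxΩ, indicator_of_mem hxΩ, hx hxΩ]
    · rw [indicator_of_notMem hxΩ, indicator_of_notMem hxΩ]
  have h1 : LocallyIntegrable (Ω.indicator p) volume :=
    hp.locallyIntegrable.indicator ho.measurableSet
  have h2 : LocallyIntegrable (Ω.indicator (jetExt Ω p 0)) volume :=
    h1.mono (h1.aestronglyMeasurable.congr hae) (hae.mono fun x hx => by rw [hx])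
  refine ⟨?_, t.integrable_mul h1⟩
  rw [reg_apply h2]
  refine integral_congr_ae (hae.mono fun x hx => ?_)
  simp only [hx]

/-- A piecewise smooth function is the sum of its restrictions to the gaps. -/
theorem PwSmooth.integral_eq_sum_gap {S : Finset ℝ} {p : ℝ → ℂ} (hp : PwSmooth S p) {m : ℕ}
    {ξ : Fin m → ℝ} (hξ : StrictMono ξ) (t : Test) :
    ∫ x, t x * p x = ∑ k, reg ((gap ξ k).indicator (jetExt (gap ξ k) p 0)) t := by
  have h1 := fun k => reg_indicator_jetExt_apply hp (isOpen_gap ξ k) t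
  simp only [(h1 _).1]
  rw [← integral_finsetSum _ fun k _ => (h1 k).2]
  refine integral_congr_ae ?_
  filter_upwards [(finite_range ξ).countable.ae_notMem volume] with x hx
  obtain ⟨k, hk⟩ := exists_mem_gap hξ hx
  rw [Finset.sum_eq_single_of_mem k (Finset.mem_univ k), indicator_of_mem hk]
  intro l _ hl
  rw [indicator_of_notMem fun hxl => hl (gap_unique hxl hk), mul_zero]

theorem dsupport_sum_pointDistr_subset (S : Finset ℝ) {c : ℝ → Polynomial ℂ} {I : Set ℝ}
    (h : ∀ x ∉ I, c x = 0) : Distribution.dsupport (∑ x ∈ S, pointDistr x (c x) : Distr) ⊆ I := by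
  classical
  intro x hx
  by_contra hxI
  refine (Distribution.notMem_dsupport_iff x).mpr
    ⟨((S.filter fun y => c y ≠ 0 : Finset ℝ) : Set ℝ)ᶜ, fun t ht => ?_, isOpen_compl_finset _, ?_⟩ hx
  · rw [sum_apply]
    refine Finset.sum_eq_zero fun y hy => ?_
    rw [pointDistr_apply]
    by_cases hc : c y = 0
    · rw [hc, pairing_zero]
    · rw [jet_eq_zero fun hyt => ht hyt (by simp [hy, hc])]
      exact pairing_zero_right _
  · simp [h x hxI]

end DistODE

open DistODE
theorem theorem2p10 (n : ℕ) (a b : Fin (n + 1) → Distr) (f : ℝ → ℂ)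
    (ha : ∀ i, a i ∈ 𝒜) (hb : ∀ i, b i ∈ 𝒜) (hf : ContDiff ℝ ∞ f)
    (m : ℕ) (ξ : Fin m → ℝ) (hξ : StrictMono ξ) (hI : Set.range ξ = singularSet a b)
    (hC1 : ∀ x ∈ singularSet a b, ∀ c d : ℂ,
      IsLeftValue (a (Fin.last n)) x c → IsRightValue (b (Fin.last n)) x d → c + d ≠ 0)
    (hC2 : ∀ Ω : Set ℝ, IsOpen Ω → Ω.OrdConnected → Disjoint Ω (singularSet a b) →
      ∀ α β : ℝ → ℂ, IsSmoothExt (a (Fin.last n)) Ω α → IsSmoothExt (b (Fin.last n)) Ω β →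
        ∀ x ∈ closure Ω, α x + β x ≠ 0)
    (ψ : Distr) (hψ : IsSolution a b f ψ) :
    ∃ (ψ' : Fin (m + 1) → ℝ → ℂ) (Δ : Distr),
      ψ = (∑ k, reg ((gap ξ k).indicator (ψ' k))) + Δ ∧
      (∀ k, ContDiffOn ℝ ∞ (ψ' k) (closure (gap ξ k)) ∧
        ∃ α β : Fin (n + 1) → ℝ → ℂ,
          (∀ i, IsSmoothExt (a i) (gap ξ k) (α i)) ∧
          (∀ i, IsSmoothExt (b i) (gap ξ k) (β i)) ∧
          ∀ x ∈ closure (gap ξ k),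
            ∑ i : Fin (n + 1),
              (α i x + β i x) * iteratedDerivWithin i (ψ' k) (closure (gap ξ k)) x = f x) ∧
      (maxOrd a b ≤ n → Δ = 0) ∧
      ((n : ℕ∞) < maxOrd a b →
        Distribution.dsupport Δ ⊆ singularSet a b ∧ ord Δ ≤ maxOrd a b - n) := by
  classical
  -- normal forms of all the data, with a common exceptional set
  choose Sa α A hα using fun i => exists_rep (ha i)
  choose Sb β B hβ using fun i => exists_rep (hb i)
  obtain ⟨Sψ, p, c, hpψ⟩ := exists_rep hψ.1
  set S : Finset ℝ := Finset.univ.biUnion Sa ∪ Finset.univ.biUnion Sb ∪ Sψ with hS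
  have hα' : ∀ i, Rep S (α i) (A i) (a i) := fun i => (hα i).mono fun x hx => by
    simp only [hS, Finset.mem_union, Finset.mem_biUnion, Finset.mem_univ, true_and]
    exact Or.inl (Or.inl ⟨i, hx⟩)
  have hβ' : ∀ i, Rep S (β i) (B i) (b i) := fun i => (hβ i).mono fun x hx => by
    simp only [hS, Finset.mem_union, Finset.mem_biUnion, Finset.mem_univ, true_and]
    exact Or.inl (Or.inr ⟨i, hx⟩)
  have hp : Rep S p c ψ := hpψ.mono Finset.subset_union_right
  obtain ⟨hfun, hpt⟩ := hψ.normalForm hα' hβ' hp hf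
  have hjets := sum_jetMul_eq (fun i => (hα' i).pwSmooth) (fun i => (hβ' i).pwSmooth) hp.pwSmooth
    hf hfun
  have hrega : ∀ x ∉ singularSet a b, ∀ i, x ∉ singSupp (a i) := fun x hx i h =>
    hx (mem_iUnion.mpr ⟨i, Or.inl h⟩)
  have hregb : ∀ x ∉ singularSet a b, ∀ i, x ∉ singSupp (b i) := fun x hx i h =>
    hx (mem_iUnion.mpr ⟨i, Or.inr h⟩)
  have hgap : ∀ k, Disjoint (gap ξ k) (singularSet a b) := fun k => hI ▸ disjoint_gap_range ξ k
  have hgapa : ∀ k i, IsSmoothExt (a i) (gap ξ k) (jetExt (gap ξ k) (α i) 0) := fun k i =>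
    (hα' i).isSmoothExt (isOpen_gap ξ k) (ordConnected_gap ξ k)
      ((hgap k).mono_right fun x hx => mem_iUnion.mpr ⟨i, Or.inl hx⟩)
  have hgapb : ∀ k i, IsSmoothExt (b i) (gap ξ k) (jetExt (gap ξ k) (β i) 0) := fun k i =>
    (hβ' i).isSmoothExt (isOpen_gap ξ k) (ordConnected_gap ξ k)
      ((hgap k).mono_right fun x hx => mem_iUnion.mpr ⟨i, Or.inr hx⟩)
  -- the leading coefficient of the equation of point functionals
  have hlead : ∀ x, (leftJet (α (Fin.last n)) x + rightJet (β (Fin.last n)) x) 0 ≠ 0 := by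
    intro x
    by_cases hx : x ∈ singularSet a b
    · exact hC1 x hx _ _ ((hα' _).isLeftValue x) ((hβ' _).isRightValue x)
    · obtain ⟨k, hk⟩ := exists_mem_gap hξ (hI ▸ hx)
      have h1 := hC2 (gap ξ k) (isOpen_gap ξ k) (ordConnected_gap ξ k) (hgap k) _ _
        (hgapa k (Fin.last n)) (hgapb k (Fin.last n)) x (subset_closure hk)
      rw [jetExt_of_mem (isOpen_gap ξ k) hk, jetExt_of_mem (isOpen_gap ξ k) hk] at h1
      rwa [((hα' _).eq_zero_and_jet_eq (hrega x hx _)).2]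
  have hptreg : ∀ x ∉ singularSet a b, ∑ i : Fin (n + 1),
      contract (derivCoeff S p c i x) (leftJet (α i) x + rightJet (β i) x) = 0 := by
    intro x hx
    have h1 := hpt x
    simp only [((hα' _).eq_zero_and_jet_eq (hrega x hx _)).1,
      ((hβ' _).eq_zero_and_jet_eq (hregb x hx _)).1, contract_zero, add_zero,
      Finset.sum_const_zero] at h1
    exact h1
  -- at the regular points the solution has neither a point part nor jumps
  have hcreg : ∀ x ∉ singularSet a b, c x = 0 := fun x hx => Polynomial.ext fun j =>
    coeff_eq_zero_of_equation (M := 0) (E := 0) (by rw [add_zero]; exact hptreg x hx) (by simp)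
      (hlead x) (Nat.zero_le _)
  have hpreg : ∀ x ∉ singularSet a b, leftJet p x = rightJet p x := by
    intro x hx
    have h1 : ∑ i : Fin (n + 1), jetMul (leftJet (α i) x + rightJet (β i) x)
        (fun j => (rightJet p x - leftJet p x) (j + i)) = 0 := by
      have h2 : ∀ i : Fin (n + 1), (fun j => (rightJet p x - leftJet p x) (j + i)) =
          rightJet (iteratedDeriv i p) x - leftJet (iteratedDeriv i p) x := fun i => by
        funext j
        simp only [Pi.sub_apply, leftJet_iteratedDeriv, rightJet_iteratedDeriv]
      simp only [h2, jetMul_sub, Finset.sum_sub_distrib]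
      obtain ⟨h3, h4⟩ := hjets x
      simp only [((hβ' _).eq_zero_and_jet_eq (hregb x hx _)).2] at h3
      simp only [← ((hα' _).eq_zero_and_jet_eq (hrega x hx _)).2] at h4
      rw [h3, h4, sub_self]
    have h5 := jump_eq_zero h1 (hlead x) fun l hl =>
      jump_eq_zero_of_equation (hptreg x hx) (hlead x) hl
    funext l
    exact (sub_eq_zero.mp (h5 l)).symm
  have hpgap : ∀ k, ∀ x ∈ gap ξ k, leftJet p x = rightJet p x := fun k x hx =>
    hpreg x (disjoint_left.mp (hgap k) hx)
  -- the order estimate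
  have hcoeff : ∀ M : ℕ, maxOrd a b ≤ M → ∀ x j, M ≤ j + n → (c x).coeff j = 0 := by
    intro M hM x j hj
    have hle : ∀ i, max (ord (a i)) (ord (b i)) ≤ M := fun i =>
      (Finset.le_sup (f := fun i => max (ord (a i)) (ord (b i))) (Finset.mem_univ i)).trans hM
    refine coeff_eq_zero_of_equation (hpt x) (fun l hl => ?_) (hlead x) hj
    rw [Polynomial.finsetSum_coeff]
    refine Finset.sum_eq_zero fun i _ => ?_
    rw [Polynomial.coeff_add, coeff_contract_eq_zero (fun q hq => (hα' i).coeff_eq_zero_of_ord_le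
        ((le_max_left _ _).trans (hle i)) x hq) _ hl,
      coeff_contract_eq_zero (fun q hq => (hβ' i).coeff_eq_zero_of_ord_le
        ((le_max_right _ _).trans (hle i)) x hq) _ hl, add_zero]
  refine ⟨fun k => jetExt (gap ξ k) p 0, ∑ x ∈ S, pointDistr x (c x), ?_, fun k => ⟨?_, ?_⟩,
    fun hM => ?_, fun hM => ⟨dsupport_sum_pointDistr_subset S hcreg, ?_⟩⟩
  · ext t
    rw [hp.apply, hp.pwSmooth.integral_eq_sum_gap hξ]
    simp only [add_apply, sum_apply, pointDistr_apply]
  · exact hp.pwSmooth.contDiffOn_jetExt (isOpen_gap ξ k) (ordConnected_gap ξ k) (hpgap k)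
  · refine ⟨_, _, hgapa k, hgapb k, fun x hx => ?_⟩
    have h1 : ∀ i : Fin (n + 1), iteratedDerivWithin i (jetExt (gap ξ k) p 0) (closure (gap ξ k)) x
        = jetExt (gap ξ k) p i x := fun i => hp.pwSmooth.iteratedDerivWithin_jetExt
      (isOpen_gap ξ k) (ordConnected_gap ξ k) (hpgap k) i hx
    obtain ⟨h3, h4⟩ := hjets x
    have h3' := congrFun h3 0
    have h4' := congrFun h4 0
    simp only [Finset.sum_apply, jetMul, leftJet_iteratedDeriv, rightJet_iteratedDeriv,
      jet_zero] at h3' h4'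
    simp only [h1, jetExt]
    split_ifs with hside
    · simpa using h4'
    · simpa using h3'
  · refine Finset.sum_eq_zero fun x _ => ?_
    have hc0 : c x = 0 := Polynomial.ext fun j => hcoeff n hM x j (by lia)
    ext t
    rw [pointDistr_apply, hc0, pairing_zero]
    rfl
  · rcases eq_or_ne (maxOrd a b) ⊤ with htop | htop
    · rw [htop, ENat.top_sub_natCast]
      exact le_top
    · obtain ⟨M, hMeq⟩ := ENat.ne_top_iff_exists.mp htop
      rw [← hMeq, ← ENat.natCast_sub]
      exact ord_sum_pointDistr_le c fun x j hj => hcoeff M hMeq.ge x j (by lia)
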